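/- Let $\mathcal P(n)$ be the power set of $[n]=\{1,\dots,n\}$ ordered by inclusion, and let $\mathcal P(n,p)$ be the random induced subposet obtained by retaining each element of $\mathcal P(n)$ independently with probability $p$. An event holds w.h.p. if its probability tends to $1$ as $n\to\infty$. A copy of a poset $F$ in a poset $R$ is the image of an injective order-preserving map $F\to R$ (not necessarily induced). $R$ is $(F,r)$-Ramsey if every colouring of the elements of $R$ with $r$ colours yields a monochromatic copy of $F$, and $R$ is $(P,Q)$-Ramsey if every colouring of the elements of $R$ with colours $1,2$ yields a copy of $P$ in colour $1$ or a copy of $Q$ in colour $2$. Put $$c_{\mathrm{Ram}}^-(P,Q)=\sup\{c>0:\ \mathcal P(n,e^{-cn})\text{ is }(P,Q)\text{-Ramsey w.h.p.}\},$$ $$c_{\mathrm{Ram}}^+(P,Q)=\inf\{c>0:\ \mathcal P(n,e^{-cn})\text{ is not }(P,Q)\text{-Ramsey w.h.p.}\}.$$ For a nonempty finite poset $P$ let $\mathcal A(P)$ be its set of antichains (including $\emptyset$). For $Q\subseteq P$ and $S\in\mathcal A(P)$ let $\partial_Q S$ be the set of minimal elements of $\{y\in Q:\ \exists x\in S,\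 x\le y\}$. For a probability vector $\alpha=(\alpha_S)_{S\in\mathcal A(P)}$ and $\emptyset\ne Q\subseteq P$, put $\beta_T=\sum_{S:\,\partial_Q S=T}\alpha_S$ for each $T\in\mathcal A(Q)$ and $c_{\alpha,P}(Q)=\frac1{|Q|}\sum_{T\in\mathcal A(Q)}-\beta_T\log\beta_T$ (natural logarithm, $0\log 0=0$). Define $$c_\star(P)=\sup\{c\ge 0:\ \exists\alpha\ \forall\,\emptyset\ne Q\subseteq P,\ c\le c_{\alpha,P}(Q)\}.$$ Let $C(1,2,1,2,1)$ be the $7$-element poset consisting of five consecutive levels of sizes $1,2,1,2,1$, where $x<y$ if and only if the level of $x$ is strictly below the level of $y$. Let $H$ be the poset on $v_1,\dots,v_{11}$ whose order is generated by the relations $v_{11}<v_9,v_{10}$; $v_9<v_4,v_5,v_6$; $v_{10}<v_6,v_7,v_8$; $v_4,v_5,v_6<v_2$; $v_6,v_7,v_8<v_3$; $v_2,v_3<v_1$. **Theorem.** Let $c\ge 0$ be fixed and $p=e^{-cn}$. (i) If $c<0.3250121326$, then w.h.p. $\mathcal P(n,p)$ is $(\mathcal P(2),2)$-Ramsey. (ii)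 If $c>0.3289037391$, then w.h.p. $\mathcal P(n,p)$ is not $(\mathcal P(2),2)$-Ramsey. Moreover, $H$ is $(\mathcal P(2),\mathcal P(2))$-Ramsey and $$c_\star(H)\le c_{\mathrm{Ram}}^-(\mathcal P(2),\mathcal P(2))\le c_{\mathrm{Ram}}^+(\mathcal P(2),\mathcal P(2))\le c_\star(C(1,2,1,2,1)).$$ -/

import Mathlib

open Filter Topology MeasureTheory ProbabilityTheory

namespace RandomPoset

/-! ### Copies and Ramsey properties -/

/-- A copy of the poset `F` in the poset `R` all of whose elements have colour `i` under the
colouring `χ`: an injective (not necessarily induced) poset homomorphism `F → R` with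
image of colour `i`. -/
def HasMonoCopy {F R K : Type*} [PartialOrder F] [PartialOrder R] (χ : R → K) (i : K) : Prop :=
  ∃ φ : F → R, Function.Injective φ ∧ Monotone φ ∧ ∀ x, χ (φ x) = i

/-- `R` is `(F, r)`-Ramsey: every `r`-colouring of the elements of `R` yields a monochromatic
copy of `F`. -/
def IsRamsey (F : Type*) [PartialOrder F] (r : ℕ) (R : Type*) [PartialOrder R] : Prop :=
  ∀ χ : R → Fin r, ∃ i : Fin r, HasMonoCopy (F := F) χ i

/-- `R` is `(P, Q)`-Ramsey: every 2-colouring of the elements of `R` yields a copy of `P` in the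
first colour or a copy of `Q` in the second colour. -/
def IsRamseyPair (P Q : Type*) [PartialOrder P] [PartialOrder Q] (R : Type*) [PartialOrder R] :
    Prop :=
  ∀ χ : R → Fin 2, HasMonoCopy (F := P) χ 0 ∨ HasMonoCopy (F := Q) χ 1

/-! ### The random poset -/

/-- The retention probability `p = exp (-c n)`, as a point of `[0,1]`
(for `c < 0` it is truncated to `1`). -/
noncomputable def retention (c : ℝ) (n : ℕ) : unitInterval :=
  Set.projIcc 0 1 zero_le_one (Real.exp (-(c * n)))

theorem coe_retention {c : ℝ} (hc : 0 ≤ c) (n : ℕ) :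
    (retention c n : ℝ) = Real.exp (-(c * n)) := by
  have h : Real.exp (-(c * n)) ∈ Set.Icc (0 : ℝ) 1 :=
    ⟨(Real.exp_pos _).le, Real.exp_le_one_iff.2 (neg_nonpos.2 (by positivity))⟩
  rw [retention, Set.projIcc_of_mem zero_le_one h]

/-- The law of `𝒫(n, p)`: each of the `2 ^ n` elements of the Boolean lattice `Finset (Fin n)` is
retained independently with probability `p`. A sample `S : Set (Finset (Fin n))` is viewed as a
poset with the order (inclusion) inherited from `Finset (Fin n)`. -/
noncomputable def law (n : ℕ) (p : unitInterval) : Measure (Set (Finset (Fin n))) :=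
  setBernoulli Set.univ p

/-- With high probability `𝒫(n, exp (-c n))` has property `A`: the probability of `A` tends to
`1` as `n → ∞`. -/
def WHP (c : ℝ) (A : ∀ n : ℕ, Set (Finset (Fin n)) → Prop) : Prop :=
  Tendsto (fun n : ℕ => law n (retention c n) {S | A n S}) atTop (𝓝 1)

/-- The lower Ramsey exponent of `(P, Q)`. -/
noncomputable def cRamLower (P Q : Type*) [PartialOrder P] [PartialOrder Q] : ℝ :=
  sSup {c : ℝ | 0 < c ∧ WHP c fun _ S => IsRamseyPair P Q S}

/-- The upper Ramsey exponent of `(P, Q)`. -/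
noncomputable def cRamUpper (P Q : Type*) [PartialOrder P] [PartialOrder Q] : ℝ :=
  sInf {c : ℝ | 0 < c ∧ WHP c fun _ S => ¬ IsRamseyPair P Q S}

/-! ### The critical exponent of a finite poset -/

section CriticalExponent

variable {P : Type*} [PartialOrder P]

open Classical in
/-- The antichains (including the empty one) of the subposet `Q`. -/
noncomputable def antichains (Q : Finset P) : Finset (Finset P) :=
  Q.powerset.filter fun S => IsAntichain (· ≤ ·) (S : Set P)

open Classical in
/-- The (upper) shadow of `S` in `Q`: the minimal elements of
`{y ∈ Q | ∃ x ∈ S, x ≤ y}`. -/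
noncomputable def shadow (Q S : Finset P) : Finset P :=
  Q.filter fun y => (∃ x ∈ S, x ≤ y) ∧ ∀ z ∈ Q, z < y → ∀ x ∈ S, ¬ x ≤ z

variable [Fintype P]

open Classical in
/-- The weighting induced in `Q` by a weighting `α` of the antichains of `P`: the weight of an
antichain `T` of `Q` is the total weight of the antichains of `P` whose shadow in `Q` is `T`. -/
noncomputable def inducedWeight (α : antichains (Finset.univ : Finset P) → ℝ) (Q T : Finset P) :
    ℝ :=
  ∑ S : antichains (Finset.univ : Finset P), if shadow Q S.1 = T then α S else 0

/-- The critical exponent of `Q` in `P` with respect to `α`: the entropy of the induced weighting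
divided by `|Q|`. -/
noncomputable def relExponent (α : antichains (Finset.univ : Finset P) → ℝ) (Q : Finset P) : ℝ :=
  (∑ T ∈ antichains Q, Real.negMulLog (inducedWeight α Q T)) / (Q.card : ℝ)

variable (P) in
/-- The critical exponent `c_⋆(P)` of a nonempty finite poset `P`. -/
noncomputable def cStar : ℝ :=
  sSup {c : ℝ | 0 ≤ c ∧ ∃ α ∈ stdSimplex ℝ (antichains (Finset.univ : Finset P)),
    ∀ Q : Finset P, Q.Nonempty → c ≤ relExponent α Q}

end CriticalExponent

/-! ### Specific posets -/

/-- The poset `C(n₁, …, n_t)`: disjoint levels of sizes `n₁, …, n_t`, with every element of a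
level below every element of each later level, and distinct elements of the same level
incomparable. -/
def Levels {t : ℕ} (n : Fin t → ℕ) : Type := Σ i : Fin t, Fin (n i)

instance {t : ℕ} (n : Fin t → ℕ) : Fintype (Levels n) :=
  inferInstanceAs (Fintype (Σ i : Fin t, Fin (n i)))

instance {t : ℕ} (n : Fin t → ℕ) : PartialOrder (Levels n) where
  le x y := x = y ∨ x.1 < y.1
  le_refl _ := Or.inl rfl
  le_trans x y z := by
    rintro (rfl | h) (rfl | h')
    · exact Or.inl rfl
    · exact Or.inr h'
    · exact Or.inr h
    · exact Or.inr (h.trans h')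
  le_antisymm x y := by
    rintro (rfl | h) (h' | h')
    · rfl
    · rfl
    · exact h'.symm
    · exact absurd (h.trans h') (lt_irrefl _)

/-- The ground set of the 11-element poset `H`. -/
inductive H
  | v1 | v2 | v3 | v4 | v5 | v6 | v7 | v8 | v9 | v10 | v11
  deriving DecidableEq

instance : Fintype H where
  elems := {.v1, .v2, .v3, .v4, .v5, .v6, .v7, .v8, .v9, .v10, .v11}
  complete := by intro x; cases x <;> decide

/-- The elements of `H` covering a given element (the Hasse diagram of `H`). -/
def H.covers : H → List H
  | .v11 => [.v9, .v10]
  | .v10 => [.v6, .v7, .v8]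
  | .v9 => [.v4, .v5, .v6]
  | .v8 => [.v3]
  | .v7 => [.v3]
  | .v6 => [.v2, .v3]
  | .v5 => [.v2]
  | .v4 => [.v2]
  | .v3 => [.v1]
  | .v2 => [.v1]
  | .v1 => []

/-- The elements of `H` strictly above a given element. -/
def H.above : H → List H
  | .v11 => [.v1, .v2, .v3, .v4, .v5, .v6, .v7, .v8, .v9, .v10]
  | .v10 => [.v1, .v2, .v3, .v6, .v7, .v8]
  | .v9 => [.v1, .v2, .v3, .v4, .v5, .v6]
  | .v8 => [.v1, .v3]
  | .v7 => [.v1, .v3]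
  | .v6 => [.v1, .v2, .v3]
  | .v5 => [.v1, .v2]
  | .v4 => [.v1, .v2]
  | .v3 => [.v1]
  | .v2 => [.v1]
  | .v1 => []

instance : PartialOrder H where
  le x y := x = y ∨ y ∈ x.above
  le_refl _ := Or.inl rfl
  le_trans := by decide
  le_antisymm := by decide

theorem H.le_def (x y : H) : x ≤ y ↔ x = y ∨ y ∈ x.above := Iff.rfl

/-- The order on `H` is the one given by the Hasse diagram `H.covers`. -/
theorem H.le_iff_reflTransGen (x y : H) :
    x ≤ y ↔ Relation.ReflTransGen (fun a b : H => b ∈ a.covers) x y := by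
  constructor
  · have key : ∀ x y : H, y ∈ x.above →
        ∃ z ∈ x.covers, z = y ∨ (y ∈ z.above ∧ z.above.length < x.above.length) := by decide
    have main : ∀ (k : ℕ) (x : H), x.above.length ≤ k → y ∈ x.above →
        Relation.ReflTransGen (fun a b : H => b ∈ a.covers) x y := by
      intro k
      induction k with
      | zero =>
        intro x hx hy
        rw [List.eq_nil_of_length_eq_zero (Nat.le_zero.1 hx)] at hy
        exact absurd hy List.not_mem_nil
      | succ k ih =>
        intro x hx hy
        obtain ⟨z, hz, rfl | ⟨h, hl⟩⟩ := key x y hy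
        · exact .single hz
        · exact .head hz (ih z (by omega) h)
    rintro (rfl | h)
    · exact .refl
    · exact main _ x le_rfl h
  · have step : ∀ a b : H, b ∈ a.covers → b ∈ a.above := by decide
    intro h
    induction h with
    | refl => exact le_rfl
    | tail _ h ih => exact ih.trans (Or.inr (step _ _ h))

end RandomPoset

open RandomPoset

/-! Coordinate by coordinate, a monotone map from `P` to the Boolean lattice is a sequence of `n`
up-sets of `P`, each coded by its antichain of minimal elements. If these antichains have empirical
law `α`, the restriction of the map to `Q` is one of roughly `exp (n h)` of its type, where `h` is
the entropy of the shadow in `Q`; when injective, its image survives with probability `exp (-c n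
|Q|)`. Hence `cStar P` is the threshold for containing a copy of `P`. Above it, every map has a
restriction of too low entropy to some `Q`, and a first moment bound over such restrictions suffices
(`whp_not_hasCopy`). Below it, the second moment of a weighted count of typical maps is dominated by
pairs of disjoint copies (`whp_hasCopy`).

The Ramsey statements reduce to containment. `H` is Ramsey for the diamond by a finite check, so a
copy of `H` suffices. Conversely, colouring the tops of diamonds against all other elements leaves a
monochromatic diamond only if two diamonds are stacked, which is a copy of `C(1,2,1,2,1)`
(`not_ramsey_of_not_hasCopy`). Monotonicity in the retention probability orders the two Ramsey
exponents.

The numerical bounds come from certificates. For `C(1,2,1,2,1)`, Gibbs' inequality turns the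
constraints for the whole poset and for its two extreme elements into linear inequalities in a
single weight (`cStar_levels_le`). For `H`, an explicit law, built from ten up-sets with weights
over 388 and four fair coins, gives `53 / 113 * log 2` (`le_cStar_H`): the coins are peeled off by
submodularity of entropy, and the rest is integer arithmetic. -/

namespace RandomPoset

/-! ### Entropy of functions on a finite weighted set -/

section Entropy

open Real

variable {ι κ κ' κ'' : Type*} [Fintype ι]

open Classical in
/-- The total weight of the fibre of `f` over `t`. -/
noncomputable def marg (α : ι → ℝ) (f : ι → κ) (t : κ) : ℝ := ∑ i, if f i = t then α i else 0

/-- The entropy of `f` with respect to the weights `α`. -/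
noncomputable def ent (α : ι → ℝ) (f : ι → κ) : ℝ := -∑ i, α i * log (marg α f (f i))

variable {α : ι → ℝ}

theorem marg_nonneg (hα : ∀ i, 0 ≤ α i) (f : ι → κ) (t : κ) : 0 ≤ marg α f t :=
  Finset.sum_nonneg fun i _ => by split_ifs <;> simp [hα]

theorem le_marg (hα : ∀ i, 0 ≤ α i) (f : ι → κ) (i : ι) : α i ≤ marg α f (f i) := by
  classical
  have := Finset.single_le_sum (f := fun j => if f j = f i then α j else 0)
    (fun j _ => by split_ifs <;> simp [hα]) (Finset.mem_univ i)
  simpa [marg] using this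

theorem marg_pos (hα : ∀ i, 0 ≤ α i) (f : ι → κ) {i : ι} (hi : 0 < α i) :
    0 < marg α f (f i) := hi.trans_le (le_marg hα f i)

theorem sum_mul_comp (α : ι → ℝ) {f : ι → κ} {s : Finset κ} (hs : ∀ i, f i ∈ s) (G : κ → ℝ) :
    ∑ i, α i * G (f i) = ∑ t ∈ s, marg α f t * G t := by
  classical
  simp only [marg, Finset.sum_mul]
  rw [Finset.sum_comm]
  refine Finset.sum_congr rfl fun i _ => ?_
  rw [Finset.sum_eq_single_of_mem (f i) (hs i)]
  · simp
  · intro b _ hb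
    simp [hb.symm]

theorem sum_marg (α : ι → ℝ) {f : ι → κ} {s : Finset κ} (hs : ∀ i, f i ∈ s) :
    ∑ t ∈ s, marg α f t = ∑ i, α i := by
  simpa using (sum_mul_comp α hs fun _ => 1).symm

theorem ent_eq_sum_negMulLog (α : ι → ℝ) {f : ι → κ} {s : Finset κ} (hs : ∀ i, f i ∈ s) :
    ent α f = ∑ t ∈ s, negMulLog (marg α f t) := by
  rw [ent, sum_mul_comp α hs fun t => log (marg α f t)]
  simp [negMulLog]

theorem marg_congr {f : ι → κ} {g : ι → κ'} {i : ι} (h : ∀ j, f j = f i ↔ g j = g i) :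
    marg α f (f i) = marg α g (g i) := by
  classical
  unfold marg
  exact Finset.sum_congr rfl fun j _ => if_congr (h j) rfl rfl

/-- Entropy depends only on the partition into fibres, so observations can be recoded freely. -/
theorem ent_congr {f : ι → κ} {g : ι → κ'} (h : ∀ i j, f i = f j ↔ g i = g j) :
    ent α f = ent α g := by
  simp only [ent]
  congr 1
  exact Finset.sum_congr rfl fun i _ => by rw [marg_congr fun j => h j i]

/-- Gibbs' inequality in the form needed for comparing logarithms termwise. -/
theorem sum_mul_log_le {u v : ι → ℝ} (hα : α ∈ stdSimplex ℝ ι) (hu : ∀ i, 0 < α i → 0 < u i)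
    (hv : ∀ i, 0 < α i → 0 < v i) (h : ∑ i, α i * (u i / v i) ≤ 1) :
    ∑ i, α i * log (u i) ≤ ∑ i, α i * log (v i) := by
  have key : ∀ i, α i * log (u i) ≤ α i * log (v i) + (α i * (u i / v i) - α i) := by
    intro i
    rcases (hα.1 i).eq_or_lt with h0 | h0
    · simp [← h0]
    · have := log_le_sub_one_of_pos (div_pos (hu i h0) (hv i h0))
      rw [log_div (hu i h0).ne' (hv i h0).ne'] at this
      nlinarith
  have := Finset.sum_le_sum fun i (_ : i ∈ Finset.univ) => key i
  rw [Finset.sum_add_distrib, Finset.sum_sub_distrib, hα.2] at this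
  linarith

/-- Gibbs' inequality against a fixed subprobability `r`. The bound is linear in `α`, so a single
`r` bounds the entropy for all weightings at once. -/
theorem ent_le_cross (hα : α ∈ stdSimplex ℝ ι) {f : ι → κ} {s : Finset κ} (hs : ∀ i, f i ∈ s)
    {r : κ → ℝ} (hr : ∀ t ∈ s, 0 < r t) (hr1 : ∑ t ∈ s, r t ≤ 1) :
    ent α f ≤ -∑ i, α i * log (r (f i)) := by
  refine neg_le_neg (sum_mul_log_le hα (fun i _ => hr _ (hs i)) (fun i => marg_pos hα.1 f) ?_)
  rw [sum_mul_comp α hs fun t => r t / marg α f t]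
  refine (Finset.sum_le_sum fun t ht => ?_).trans hr1
  rcases (marg_nonneg hα.1 f t).eq_or_lt with h0 | h0
  · simp [← h0, (hr t ht).le]
  · exact (mul_div_cancel₀ _ h0.ne').le

theorem marg_fst (α : ι → ℝ) (f : ι → κ) {g : ι → κ'} {s : Finset κ'} (hs : ∀ i, g i ∈ s) (t : κ) :
    ∑ u ∈ s, marg α (fun i => (f i, g i)) (t, u) = marg α f t := by
  classical
  simp only [marg]
  rw [Finset.sum_comm]
  refine Finset.sum_congr rfl fun i _ => ?_
  rw [Finset.sum_eq_single_of_mem (g i) (hs i)]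
  · simp
  · intro b _ hb
    simp [hb.symm]

/-- Strong subadditivity of entropy. -/
theorem ent_submodular (hα : α ∈ stdSimplex ℝ ι) (f : ι → κ) (g : ι → κ') (h : ι → κ'') :
    ent α (fun i => (f i, g i, h i)) + ent α f ≤
      ent α (fun i => (f i, g i)) + ent α (fun i => (f i, h i)) := by
  classical
  set p := marg α f
  set pg := marg α (fun i => (f i, g i))
  set ph := marg α (fun i => (f i, h i))
  set pp := marg α (fun i => (f i, g i, h i))
  have hp : ∀ t, 0 ≤ p t := marg_nonneg hα.1 f
  have hpg : ∀ t, 0 ≤ pg t := marg_nonneg hα.1 _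
  have hph : ∀ t, 0 ≤ ph t := marg_nonneg hα.1 _
  have hpp : ∀ t, 0 ≤ pp t := marg_nonneg hα.1 _
  -- This is Gibbs' inequality between the joint law `pp` and the law `pg * ph / p`, which makes `g`
  -- and `h` conditionally independent given `f`.
  have main : ∑ i, α i * log (pg (f i, g i) * ph (f i, h i)) ≤
      ∑ i, α i * log (pp (f i, g i, h i) * p (f i)) := by
    refine sum_mul_log_le hα
      (fun i hi => mul_pos (marg_pos hα.1 _ hi) (marg_pos hα.1 _ hi))
      (fun i hi => mul_pos (marg_pos hα.1 (fun i => (f i, g i, h i)) hi) (marg_pos hα.1 _ hi)) ?_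
    set sf := Finset.univ.image f
    set sg := Finset.univ.image g
    set sh := Finset.univ.image h
    have hsf : ∀ i, f i ∈ sf := fun i => Finset.mem_image_of_mem _ (Finset.mem_univ i)
    have hsg : ∀ i, g i ∈ sg := fun i => Finset.mem_image_of_mem _ (Finset.mem_univ i)
    have hsh : ∀ i, h i ∈ sh := fun i => Finset.mem_image_of_mem _ (Finset.mem_univ i)
    rw [sum_mul_comp α (f := fun i => (f i, g i, h i)) (s := sf ×ˢ sg ×ˢ sh)
      (fun i => by simp [hsf, hsg, hsh])
      (fun x => pg (x.1, x.2.1) * ph (x.1, x.2.2) / (pp x * p x.1))]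
    calc _ ≤ ∑ x ∈ sf ×ˢ sg ×ˢ sh, pg (x.1, x.2.1) * ph (x.1, x.2.2) / p x.1 := by
          refine Finset.sum_le_sum fun x _ => ?_
          change pp x * _ ≤ _
          rcases (hpp x).eq_or_lt with h0 | h0
          · rw [← h0, zero_mul]
            exact div_nonneg (mul_nonneg (hpg _) (hph _)) (hp _)
          · rw [← mul_div_assoc, mul_div_mul_left _ _ h0.ne']
      _ = ∑ t ∈ sf, p t := by
          rw [Finset.sum_product]
          refine Finset.sum_congr rfl fun t _ => ?_
          rw [Finset.sum_product]
          simp only [← Finset.sum_div, ← Finset.mul_sum, ← Finset.sum_mul]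
          simp only [pg, ph, marg_fst α f hsg, marg_fst α f hsh]
          -- Values of `f` of weight zero cause no trouble, since `0 * 0 / 0 = 0`.
          exact mul_self_div_self _
      _ = 1 := by rw [sum_marg α hsf, hα.2]
      _ ≤ 1 := le_rfl
  have e1 : ∑ i, α i * log (pg (f i, g i) * ph (f i, h i)) =
      ∑ i, α i * log (pg (f i, g i)) + ∑ i, α i * log (ph (f i, h i)) := by
    rw [← Finset.sum_add_distrib]
    refine Finset.sum_congr rfl fun i _ => ?_
    rcases (hα.1 i).eq_or_lt with h0 | h0
    · simp [← h0]
    · rw [log_mul (marg_pos hα.1 _ h0).ne' (marg_pos hα.1 _ h0).ne', mul_add]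
  have e2 : ∑ i, α i * log (pp (f i, g i, h i) * p (f i)) =
      ∑ i, α i * log (pp (f i, g i, h i)) + ∑ i, α i * log (p (f i)) := by
    rw [← Finset.sum_add_distrib]
    refine Finset.sum_congr rfl fun i _ => ?_
    rcases (hα.1 i).eq_or_lt with h0 | h0
    · simp [← h0]
    · rw [log_mul (marg_pos hα.1 (fun i => (f i, g i, h i)) h0).ne' (marg_pos hα.1 _ h0).ne',
        mul_add]
  simp only [ent]
  linarith

end Entropy

/-! ### Antichains, shadows and the critical exponent -/

section Shadow

variable {P : Type*} [PartialOrder P]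

theorem mem_antichains {Q S : Finset P} :
    S ∈ antichains Q ↔ S ⊆ Q ∧ IsAntichain (· ≤ ·) (S : Set P) := by
  simp [antichains]

theorem mem_shadow {Q S : Finset P} {y : P} :
    y ∈ shadow Q S ↔ y ∈ Q ∧ (∃ x ∈ S, x ≤ y) ∧ ∀ z ∈ Q, z < y → ∀ x ∈ S, ¬ x ≤ z := by
  simp [shadow]

theorem shadow_mem_antichains (Q S : Finset P) : shadow Q S ∈ antichains Q := by
  refine mem_antichains.2 ⟨fun y hy => (mem_shadow.1 hy).1, fun x hx y hy hxy hle => ?_⟩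
  obtain ⟨hxQ, ⟨w, hw, hwx⟩, -⟩ := mem_shadow.1 hx
  exact (mem_shadow.1 hy).2.2 x hxQ (lt_of_le_of_ne hle hxy) w hw hwx

/-- An antichain stands for the up-set it generates. Passing to the shadow keeps the trace of this
up-set on `Q`, because by finiteness each element of the trace lies above a minimal one. -/
theorem exists_mem_shadow_le_iff {Q S : Finset P} {x : P} (hx : x ∈ Q) :
    (∃ z ∈ shadow Q S, z ≤ x) ↔ ∃ z ∈ S, z ≤ x := by
  constructor
  · rintro ⟨z, hz, hzx⟩
    obtain ⟨-, ⟨w, hw, hwz⟩, -⟩ := mem_shadow.1 hz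
    exact ⟨w, hw, hwz.trans hzx⟩
  · rintro ⟨w, hw, hwx⟩
    classical
    obtain ⟨m, hmx, hm⟩ := (Q.filter fun y => ∃ z ∈ S, z ≤ y).exists_le_minimal
      (a := x) (by simp only [Finset.mem_filter]; exact ⟨hx, w, hw, hwx⟩)
    refine ⟨m, mem_shadow.2 ?_, hmx⟩
    have hm' := hm.prop
    simp only [Finset.mem_filter] at hm'
    refine ⟨hm'.1, hm'.2, fun z hz hzm x hx hxz => ?_⟩
    exact hm.not_lt (by simp only [Finset.mem_filter]; exact ⟨hz, x, hx, hxz⟩) hzm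

/-- The shadow is thus a faithful code for the trace on `Q`, and equality of shadows becomes
equality of memberships. -/
theorem shadow_eq_shadow_iff {Q S S' : Finset P} :
    shadow Q S = shadow Q S' ↔ ∀ x ∈ Q, (∃ z ∈ S, z ≤ x) ↔ ∃ z ∈ S', z ≤ x := by
  constructor
  · intro h x hx
    rw [← exists_mem_shadow_le_iff hx, h, exists_mem_shadow_le_iff hx]
  · intro h
    ext y
    simp only [mem_shadow]
    refine and_congr_right fun hy => and_congr (h y hy) (forall₃_congr fun z hz _ => ?_)
    have := h z hz
    constructor <;> intro H x hx hxz
    · obtain ⟨w, hw, hwz⟩ := this.2 ⟨x, hx, hxz⟩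
      exact H w hw hwz
    · obtain ⟨w, hw, hwz⟩ := this.1 ⟨x, hx, hxz⟩
      exact H w hw hwz

theorem shadow_self {S Q : Finset P} (hS : S ∈ antichains Q) : shadow Q S = S := by
  obtain ⟨hSQ, hS⟩ := mem_antichains.1 hS
  ext y
  rw [mem_shadow]
  constructor
  · rintro ⟨-, ⟨x, hx, hxy⟩, h⟩
    rcases hxy.eq_or_lt with rfl | hlt
    · exact hx
    · exact absurd le_rfl (h x (hSQ hx) hlt x hx)
  · intro hy
    refine ⟨hSQ hy, ⟨y, hy, le_rfl⟩, fun z _ hzy x hx hxz => ?_⟩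
    have := hS.eq hx hy (hxz.trans hzy.le)
    exact absurd (this ▸ hxz) hzy.not_ge

variable [Fintype P]

theorem inducedWeight_eq_marg (α : antichains (Finset.univ : Finset P) → ℝ) (Q T : Finset P) :
    inducedWeight α Q T = marg α (fun S => shadow Q S.1) T := by
  classical
  unfold inducedWeight marg
  refine Finset.sum_congr rfl fun S _ => ?_
  by_cases h : shadow Q S.1 = T <;> simp [h]

theorem relExponent_eq_ent (α : antichains (Finset.univ : Finset P) → ℝ) (Q : Finset P) :
    relExponent α Q = ent α (fun S => shadow Q S.1) / Q.card := by
  rw [relExponent, ent_eq_sum_negMulLog α (s := antichains Q)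
    fun S => shadow_mem_antichains Q S.1]
  simp only [inducedWeight_eq_marg]

variable (P) in
-- Needed because a real `sSup` bounds its members only when the set is bounded. Each entropy term
-- satisfies `-b log b ≤ 1 - b ≤ 1`.
theorem bddAbove_cStar [Nonempty P] :
    BddAbove {c : ℝ | 0 ≤ c ∧ ∃ α ∈ stdSimplex ℝ (antichains (Finset.univ : Finset P)),
      ∀ Q : Finset P, Q.Nonempty → c ≤ relExponent α Q} := by
  refine ⟨((antichains (Finset.univ : Finset P)).card : ℝ) / (Finset.univ : Finset P).card, ?_⟩
  rintro c ⟨-, α, hα, h⟩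
  refine (h Finset.univ Finset.univ_nonempty).trans ?_
  rw [relExponent]
  gcongr
  rw [← nsmul_one]
  refine Finset.sum_le_card_nsmul _ _ _ fun T _ => ?_
  rw [inducedWeight_eq_marg]
  set b := marg α (fun S => shadow Finset.univ S.1) T
  have hb : 0 ≤ b := marg_nonneg hα.1 _ _
  rcases hb.eq_or_lt with h0 | h0
  · simp [← h0]
  · have := Real.one_sub_inv_le_log_of_pos h0
    have h2 : b * b⁻¹ = 1 := mul_inv_cancel₀ h0.ne'
    rw [Real.negMulLog]
    nlinarith

theorem cStar_nonneg : 0 ≤ cStar P := Real.sSup_nonneg fun _ h => h.1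

theorem le_cStar [Nonempty P] {c : ℝ} (hc : 0 ≤ c)
    {α : antichains (Finset.univ : Finset P) → ℝ} (hα : α ∈ stdSimplex ℝ _)
    (h : ∀ Q : Finset P, Q.Nonempty → c ≤ relExponent α Q) : c ≤ cStar P :=
  le_csSup (bddAbove_cStar P) ⟨hc, α, hα, h⟩

end Shadow

/-! ### The law of the random poset -/

section Law

open Measure unitInterval
open scoped ENNReal

instance (n : ℕ) (p : unitInterval) : IsProbabilityMeasure (law n p) :=
  inferInstanceAs (IsProbabilityMeasure (setBernoulli Set.univ p))

theorem law_real_superset (n : ℕ) (p : unitInterval) (A : Finset (Finset (Fin n))) :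
    (law n p).real {S | ∀ a ∈ A, a ∈ S} = (p : ℝ) ^ A.card := by
  have h : law n p {S | ∀ a ∈ A, a ∈ S} = (toNNReal p : ℝ≥0∞) ^ A.card := by
    rw [law, setBernoulli_apply']
    have : (fun q : Finset (Fin n) → Prop => {i | q i}) ⁻¹' {S | ∀ a ∈ A, a ∈ S} =
        (A : Set (Finset (Fin n))).pi fun _ => {True} := by
      ext q
      simp [Set.pi]
    rw [this, infinitePi_pi _ fun _ _ => MeasurableSet.of_discrete]
    simp
  rw [measureReal_def, h]
  simp

/-- Coupling: with one uniform variable `u i` per element, retaining `i` when `u i ≤ r` realises all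
the laws at once, as sets increasing in `r`. -/
theorem law_mono {n : ℕ} {p q : unitInterval} (hpq : p ≤ q) {A : Set (Set (Finset (Fin n)))}
    (hA : ∀ S ∈ A, ∀ S', S ⊆ S' → S' ∈ A) : law n p A ≤ law n q A := by
  have key : ∀ r : unitInterval, law n r =
      (infinitePi fun _ : Finset (Fin n) => (volume : Measure unitInterval)).map
        fun u => {i | u i ≤ r} := by
    intro r
    have hm : Measurable fun u : unitInterval => (u ≤ r : Prop) :=
      measurableSet_setOfPred.1 measurableSet_Iic
    have h1 : toNNReal r • dirac True + toNNReal (σ r) • dirac False =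
        (volume : Measure unitInterval).map fun u => (u ≤ r : Prop) := by
      refine Measure.ext_of_singleton fun P => ?_
      rw [map_apply hm (measurableSet_singleton _)]
      by_cases hP : P
      · have : (fun u : unitInterval => (u ≤ r : Prop)) ⁻¹' {P} = Set.Iic r := by
          ext u; simp [hP]
        rw [this, unitInterval.volume_Iic]
        simp [hP]
        exact (ENNReal.ofReal_eq_coe_nnreal r.2.1).symm
      · have : (fun u : unitInterval => (u ≤ r : Prop)) ⁻¹' {P} = Set.Ioi r := by
          ext u; simp [hP]
        rw [this, unitInterval.volume_Ioi]
        simp [hP]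
        exact (ENNReal.ofReal_eq_coe_nnreal (σ r).2.1).symm
    rw [law, setBernoulli_eq_map]
    simp only [Set.mem_univ]
    rw [h1, ← infinitePi_map_pi _ fun _ => hm, Measure.map_map]
    · rfl
    · fun_prop
    · fun_prop
  have hmeas : ∀ r : unitInterval,
      Measurable fun u : Finset (Fin n) → unitInterval => {i | u i ≤ r} := fun r =>
    MeasurableEquiv.setOfPred.measurable.comp <| measurable_pi_lambda _ fun i =>
      measurableSet_setOfPred.1 ((measurable_pi_apply i) measurableSet_Iic)
  rw [key, key, map_apply (hmeas p) .of_discrete, map_apply (hmeas q) .of_discrete]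
  exact measure_mono fun u hu => hA _ hu _ fun i hi => le_trans hi hpq

/-- The second moment inequality for a weighted union of events. -/
theorem sq_sum_le_measure_iUnion {Ω τ : Type*} [Fintype Ω] [MeasurableSpace Ω]
    [MeasurableSingletonClass Ω] [Fintype τ] (μ : Measure Ω) [IsFiniteMeasure μ]
    (E : τ → Set Ω) {w : τ → ℝ} :
    (∑ s, w s * μ.real (E s)) ^ 2 ≤
      μ.real (⋃ s, E s) * ∑ s, ∑ t, w s * w t * μ.real (E s ∩ E t) := by
  classical
  have hreal : ∀ A : Set Ω, μ.real A = ∑ ω, μ.real {ω} * A.indicator 1 ω := by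
    intro A
    have := integral_indicator_one (μ := μ) (s := A) (Set.toFinite A).measurableSet
    rw [← this, integral_fintype (Integrable.of_finite)]
    rfl
  set X : Ω → ℝ := fun ω => ∑ s, w s * (E s).indicator 1 ω
  have e1 : ∑ s, w s * μ.real (E s) = ∑ ω, μ.real {ω} * X ω := by
    simp only [hreal (E _), X, Finset.mul_sum]
    rw [Finset.sum_comm]
    refine Finset.sum_congr rfl fun _ _ => Finset.sum_congr rfl fun _ _ => by ring
  have e2 : ∑ s, ∑ t, w s * w t * μ.real (E s ∩ E t) = ∑ ω, μ.real {ω} * X ω ^ 2 := by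
    have hX : ∀ ω, X ω ^ 2 = ∑ s, ∑ t,
        w s * w t * ((E s).indicator 1 ω * (E t).indicator 1 ω) := fun ω => by
      rw [sq, Finset.sum_mul_sum]
      exact Finset.sum_congr rfl fun _ _ => Finset.sum_congr rfl fun _ _ => by ring
    simp only [hreal (E _ ∩ E _), hX, Finset.mul_sum, Set.inter_indicator_one, Pi.mul_apply]
    rw [Finset.sum_comm (s := (Finset.univ : Finset Ω))]
    refine Finset.sum_congr rfl fun s _ => ?_
    rw [Finset.sum_comm]
    refine Finset.sum_congr rfl fun t _ => Finset.sum_congr rfl fun ω _ => by ring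
  rw [e1, e2, hreal]
  -- Cauchy–Schwarz, using that `X` vanishes off the union and so equals its product with the
  -- indicator of the union.
  refine Finset.sum_sq_le_sum_mul_sum_of_sq_le_mul _ (fun ω _ => ?_) (fun ω _ => ?_) fun ω _ =>
    le_of_eq ?_
  · exact mul_nonneg measureReal_nonneg (Set.indicator_nonneg (by simp) _)
  · positivity
  · by_cases h : ω ∈ ⋃ s, E s
    · simp [Set.indicator_of_mem h]
      ring
    · have : X ω = 0 := Finset.sum_eq_zero fun s _ => by
        rw [Set.indicator_of_notMem fun hs => h (Set.mem_iUnion_of_mem s hs), mul_zero]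
      simp [this]

theorem whp_iff_real {c : ℝ} {A : ∀ n : ℕ, Set (Finset (Fin n)) → Prop} :
    WHP c A ↔ Tendsto (fun n => (law n (retention c n)).real {S | A n S}) atTop (𝓝 1) := by
  rw [WHP, ← ENNReal.toReal_one]
  exact (ENNReal.tendsto_toReal_iff (fun _ => measure_ne_top _ _) ENNReal.one_ne_top).symm

theorem whp_not_iff_real {c : ℝ} {A : ∀ n : ℕ, Set (Finset (Fin n)) → Prop} :
    WHP c (fun n S => ¬ A n S) ↔
      Tendsto (fun n => (law n (retention c n)).real {S | A n S}) atTop (𝓝 0) := by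
  have h : ∀ n, (law n (retention c n)).real {S | ¬ A n S} =
      1 - (law n (retention c n)).real {S | A n S} := fun n =>
    probReal_compl_eq_one_sub (s := {S | A n S}) .of_discrete
  rw [whp_iff_real]
  simp only [h]
  constructor <;> intro H
  · simpa using H.const_sub 1
  · simpa using H.const_sub 1

theorem WHP.mono {c : ℝ} {A B : ∀ n : ℕ, Set (Finset (Fin n)) → Prop} (hA : WHP c A)
    (h : ∀ n S, A n S → B n S) : WHP c B :=
  tendsto_of_tendsto_of_tendsto_of_le_of_le hA tendsto_const_nhds
    (fun n => measure_mono fun S => h n S) fun _ => prob_le_one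

end Law

/-! ### The first moment bound -/

section Types

open Real

variable {ι κ κ' : Type*} [Fintype ι]

theorem sum_marg_univ [Fintype κ] (α : ι → ℝ) (f : ι → κ) : ∑ t, marg α f t = ∑ i, α i :=
  sum_marg α fun i => Finset.mem_univ (f i)

theorem marg_mem_stdSimplex [Fintype κ] {α : ι → ℝ} (hα : α ∈ stdSimplex ℝ ι) (f : ι → κ) :
    marg α f ∈ stdSimplex ℝ κ :=
  ⟨marg_nonneg hα.1 f, by rw [sum_marg_univ, hα.2]⟩

theorem marg_marg [Fintype κ] (α : ι → ℝ) (f : ι → κ) (g : κ → κ') :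
    marg (marg α f) g = marg α fun i => g (f i) := by
  classical
  ext t
  have := sum_mul_comp α (fun i => Finset.mem_univ (f i)) fun s => if g s = t then 1 else 0
  simpa [marg] using this.symm

theorem ent_marg [Fintype κ] (α : ι → ℝ) (f : ι → κ) (g : κ → κ') :
    ent (marg α f) g = ent α fun i => g (f i) := by
  rw [ent, ent, sum_mul_comp α (fun i => Finset.mem_univ (f i))
    fun s => log (marg α (fun i => g (f i)) (g s)), marg_marg]

theorem const_inv_mem_stdSimplex {n : ℕ} (hn : 0 < n) :
    (fun _ => (n : ℝ)⁻¹) ∈ stdSimplex ℝ (Fin n) :=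
  ⟨fun _ => by positivity, by simp [hn.ne']⟩

/-- The probability that `n` independent draws from the empirical law of `u` reproduce `u` itself.
-/
theorem prod_marg_eq_exp {n : ℕ} (hn : 0 < n) (u : Fin n → κ) :
    ∏ i, marg (fun _ => (n : ℝ)⁻¹) u (u i) = exp (-(n * ent (fun _ => (n : ℝ)⁻¹) u)) := by
  have hn' : (n : ℝ) ≠ 0 := by positivity
  have : -(n * ent (fun _ => (n : ℝ)⁻¹) u) = ∑ i, log (marg (fun _ => (n : ℝ)⁻¹) u (u i)) := by
    rw [ent, ← Finset.mul_sum]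
    field_simp
  rw [this, exp_sum]
  exact Finset.prod_congr rfl fun i _ =>
    (exp_log (marg_pos (const_inv_mem_stdSimplex hn).1 u (by positivity))).symm

/-- The number of sequences of length `n` with empirical entropy at most `h`. -/
theorem card_ent_le [Fintype κ] {n : ℕ} (hn : 0 < n) (h : ℝ)
    (T : Finset (Fin n → κ)) (hT : ∀ u ∈ T, ent (fun _ => (n : ℝ)⁻¹) u ≤ h) :
    (T.card : ℝ) ≤ (n + 1) ^ Fintype.card κ * exp (n * h) := by
  classical
  -- Method of types. There are at most `(n + 1) ^ |κ|` types; within one type every sequence has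
  -- probability at least `exp (-(n * h))` under the common empirical law, so there are at most `exp
  -- (n * h)` of them.
  set type : (Fin n → κ) → κ → ℕ := fun u t => (Finset.univ.filter fun i => u i = t).card
  have hmarg : ∀ u, marg (fun _ => (n : ℝ)⁻¹) u = fun t => type u t * (n : ℝ)⁻¹ := fun u => by
    ext t
    simp [marg, type, ← Finset.sum_filter]
  have himg : ∀ u ∈ T, type u ∈ Fintype.piFinset fun _ : κ => Finset.range (n + 1) := fun u _ => by
    simp only [Fintype.mem_piFinset, Finset.mem_range, type]
    exact fun t => Nat.lt_succ_of_le ((Finset.card_le_univ _).trans (by simp))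
  have hfib : ∀ k ∈ Fintype.piFinset fun _ : κ => Finset.range (n + 1),
      ((T.filter fun u => type u = k).card : ℝ) ≤ exp (n * h) := by
    intro k _
    rcases (T.filter fun u => type u = k).eq_empty_or_nonempty with h0 | ⟨u₀, hu₀⟩
    · rw [h0]; simp [exp_nonneg]
    set β := marg (fun _ => (n : ℝ)⁻¹) u₀
    have hβ : ∀ u ∈ T.filter fun u => type u = k, exp (-(n * h)) ≤ ∏ i, β (u i) := by
      intro u hu
      have : β = marg (fun _ => (n : ℝ)⁻¹) u := by
        simp only [β, hmarg, (Finset.mem_filter.1 hu).2, (Finset.mem_filter.1 hu₀).2]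
      rw [this, prod_marg_eq_exp hn]
      gcongr
      exact hT u (Finset.mem_filter.1 hu).1
    have hβ0 := marg_nonneg (const_inv_mem_stdSimplex hn).1 u₀
    have h1 := Finset.card_nsmul_le_sum _ _ _ hβ
    have h2 : ∑ u ∈ T.filter fun u => type u = k, ∏ i, β (u i) ≤ 1 := by
      refine (Finset.sum_le_univ_sum_of_nonneg fun u =>
        Finset.prod_nonneg fun i _ => hβ0 _).trans ?_
      rw [← Fintype.sum_pow, sum_marg_univ, (const_inv_mem_stdSimplex hn).2, one_pow]
    have h3 := h1.trans h2
    rw [nsmul_eq_mul, exp_neg, ← div_eq_mul_inv, div_le_one (exp_pos _)] at h3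
    exact h3
  rw [Finset.card_eq_sum_card_fiberwise himg]
  push_cast
  refine (Finset.sum_le_card_nsmul _ _ _ hfib).trans (le_of_eq ?_)
  rw [nsmul_eq_mul, Fintype.card_piFinset]
  simp

end Types

/-! ### Coding of copies by sequences of up-sets, and absence of copies above the threshold -/

section FirstMoment

variable (P : Type*) [PartialOrder P]

/-- `R` contains a (not necessarily induced) copy of `P`. -/
def HasCopy (R : Type*) [PartialOrder R] : Prop :=
  ∃ φ : P → R, Function.Injective φ ∧ Monotone φ

variable {P}

/-- The element of the Boolean lattice assigned to `x` by a sequence of subsets of `P`: its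
coordinate `i` records whether `x` lies in the up-closure of `u i`. -/
def decode {n : ℕ} [DecidableLE P] (u : Fin n → Finset P) (x : P) : Finset (Fin n) :=
  Finset.univ.filter fun i => ∃ z ∈ u i, z ≤ x

theorem mem_decode {n : ℕ} [DecidableLE P] {u : Fin n → Finset P} {x : P} {i : Fin n} :
    i ∈ decode u x ↔ ∃ z ∈ u i, z ≤ x := by
  simp [decode]

theorem decode_mono {n : ℕ} [DecidableLE P] (u : Fin n → Finset P) : Monotone (decode u) := by
  intro x y hxy i
  rw [mem_decode, mem_decode]
  exact fun ⟨z, hz, hzx⟩ => ⟨z, hz, hzx.trans hxy⟩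

variable [Fintype P]

-- The empirical law `α` of the coordinates of `φ` is a candidate in the supremum `cStar P`. As `c`
-- exceeds the supremum, some `Q` violates its constraint, and the shadows in `Q` code `φ` on `Q`
-- with entropy below `|Q| c`.
open Classical in
theorem exists_low_entropy [Nonempty P] {c : ℝ} (hc : cStar P < c) {n : ℕ} (hn : 0 < n)
    [DecidableLE P] {φ : P → Finset (Fin n)} (hφ : Monotone φ) :
    ∃ Q : Finset P, Q.Nonempty ∧ ∃ u : Fin n → Finset P,
      ent (fun _ => (n : ℝ)⁻¹) u ≤ Q.card * c ∧ ∀ x ∈ Q, decode u x = φ x := by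
  set s : Fin n → antichains (Finset.univ : Finset P) := fun i =>
    ⟨shadow Finset.univ (Finset.univ.filter fun x => i ∈ φ x), shadow_mem_antichains _ _⟩
  have hs : ∀ i x, (∃ z ∈ (s i).1, z ≤ x) ↔ i ∈ φ x := by
    intro i x
    rw [exists_mem_shadow_le_iff (Finset.mem_univ x)]
    simp only [Finset.mem_filter, Finset.mem_univ, true_and]
    exact ⟨fun ⟨z, hz, hzx⟩ => hφ hzx hz, fun h => ⟨x, h, le_rfl⟩⟩
  set α := marg (fun _ => (n : ℝ)⁻¹) s
  have hα : α ∈ stdSimplex ℝ _ := marg_mem_stdSimplex (const_inv_mem_stdSimplex hn) s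
  have : ∃ Q : Finset P, Q.Nonempty ∧ relExponent α Q < c := by
    by_contra! h
    exact hc.not_ge (le_cStar (cStar_nonneg.trans hc.le) hα h)
  obtain ⟨Q, hQ, hlt⟩ := this
  refine ⟨Q, hQ, fun i => shadow Q (s i).1, ?_, fun x hx => ?_⟩
  · rw [relExponent_eq_ent, ent_marg, div_lt_iff₀ (by exact_mod_cast hQ.card_pos)] at hlt
    linarith
  · ext i
    rw [mem_decode, exists_mem_shadow_le_iff hx, hs]

/-- Above the critical exponent there is no copy with high probability. -/
theorem whp_not_hasCopy [Nonempty P] {c : ℝ} (hc : cStar P < c) :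
    WHP c fun _ S => ¬ HasCopy P S := by
  classical
  -- The entropy is bounded with `d`, the survival probability uses `c`; the gap yields a factor
  -- `exp (-((c - d) * n))` that beats the polynomial number of types.
  obtain ⟨d, hd, hdc⟩ := exists_between hc
  have hc0 : 0 ≤ c := cStar_nonneg.trans hc.le
  rw [whp_not_iff_real]
  -- `K` counts both the choices of `Q` and the letters available to a code `u`.
  set K := Fintype.card (Finset P)
  have hbound : ∀ᶠ n : ℕ in atTop, (law n (retention c n)).real {S | HasCopy P S} ≤
      K * (((n : ℝ) + 1) ^ K * Real.exp (-((c - d) * n))) := by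
    filter_upwards [eventually_gt_atTop 0] with n hn
    set I : Finset P → Finset (Fin n → Finset P) := fun Q => Finset.univ.filter fun u =>
      Q.Nonempty ∧ ent (fun _ => (n : ℝ)⁻¹) u ≤ Q.card * d ∧ Set.InjOn (decode u) Q
    set A : (Q : Finset P) → (Fin n → Finset P) → Set (Set (Finset (Fin n))) := fun Q u =>
      {S | ∀ a ∈ Q.image (decode u), a ∈ S}
    have hsub : {S : Set (Finset (Fin n)) | HasCopy P S} ⊆ ⋃ Q ∈ Finset.univ, ⋃ u ∈ I Q, A Q u := by
      rintro S ⟨φ, hinj, hmono⟩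
      obtain ⟨Q, hQ, u, hu, hdec⟩ := exists_low_entropy hd hn
        (φ := fun x => (φ x : Finset (Fin n))) hmono
      simp only [Set.mem_iUnion, exists_prop, Finset.mem_univ, true_and]
      refine ⟨Q, u, Finset.mem_filter.2 ⟨Finset.mem_univ _, hQ, hu, fun x hx y hy hxy => ?_⟩, ?_⟩
      · rw [hdec x hx, hdec y hy] at hxy
        exact hinj (Subtype.ext hxy)
      · intro a ha
        obtain ⟨x, hx, rfl⟩ := Finset.mem_image.1 ha
        rw [hdec x hx]
        exact (φ x).2
    have hterm : ∀ Q ∈ (Finset.univ : Finset (Finset P)),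
        (law n (retention c n)).real (⋃ u ∈ I Q, A Q u) ≤
          ((n : ℝ) + 1) ^ K * Real.exp (-((c - d) * n)) := by
      intro Q _
      rcases Q.eq_empty_or_nonempty with h0 | hQ
      · have : I Q = ∅ := by simp [I, h0]
        rw [this]
        simp only [Finset.notMem_empty, Set.iUnion_of_empty, Set.iUnion_empty, measureReal_empty]
        positivity
      have hcard : ∀ u ∈ I Q, (law n (retention c n)).real (A Q u) =
          Real.exp (-(c * n)) ^ Q.card := by
        intro u hu
        rw [law_real_superset, Finset.card_image_of_injOn (Finset.mem_filter.1 hu).2.2.2,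
          coe_retention hc0]
      refine (measureReal_biUnion_finset_le _ _).trans ?_
      rw [Finset.sum_congr rfl hcard, Finset.sum_const, nsmul_eq_mul]
      have h1 := card_ent_le hn (Q.card * d) (I Q) fun u hu => (Finset.mem_filter.1 hu).2.2.1
      refine (mul_le_mul_of_nonneg_right h1 (by positivity)).trans ?_
      rw [mul_assoc, ← Real.exp_nat_mul, ← Real.exp_add]
      gcongr
      have hQ1 : (1 : ℝ) ≤ Q.card := by exact_mod_cast hQ.card_pos
      have : 0 ≤ (c - d) * n := by have := sub_pos.2 hdc; positivity
      nlinarith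
    refine (measureReal_mono hsub (measure_ne_top _ _)).trans
      ((measureReal_biUnion_finset_le _ _).trans ?_)
    refine (Finset.sum_le_card_nsmul _ _ _ hterm).trans (le_of_eq ?_)
    rw [nsmul_eq_mul, Finset.card_univ]
  have hlim : Tendsto (fun n : ℕ => (K : ℝ) * (((n : ℝ) + 1) ^ K * Real.exp (-((c - d) * n))))
      atTop (𝓝 0) := by
    have h1 := (tendsto_rpow_mul_exp_neg_mul_atTop_nhds_zero K (c - d) (sub_pos.2 hdc)).comp
      (tendsto_atTop_add_const_right _ (1 : ℝ) tendsto_natCast_atTop_atTop)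
    have h2 := h1.const_mul (K * Real.exp (c - d))
    rw [mul_zero] at h2
    refine h2.congr fun n => ?_
    simp only [Function.comp, Real.rpow_natCast]
    have : Real.exp (-((c - d) * n)) = Real.exp (c - d) * Real.exp (-(c - d) * (n + 1)) := by
      rw [← Real.exp_add]
      ring_nf
    rw [this]
    ring
  exact squeeze_zero' (Eventually.of_forall fun n => measureReal_nonneg) hbound hlim

end FirstMoment

/-! ### The second moment bound -/

section Chernoff

theorem sum_union_le_of_nonneg {τ : Type*} [DecidableEq τ] {f : τ → ℝ} (hf : ∀ x, 0 ≤ f x)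
    (s t : Finset τ) : ∑ x ∈ s ∪ t, f x ≤ ∑ x ∈ s, f x + ∑ x ∈ t, f x := by
  rw [← Finset.sum_union_inter]
  exact le_add_of_nonneg_right (Finset.sum_nonneg fun x _ => hf x)

theorem sum_biUnion_le_of_nonneg {σ τ : Type*} [DecidableEq τ] {f : τ → ℝ} (hf : ∀ x, 0 ≤ f x)
    (s : Finset σ) (B : σ → Finset τ) :
    ∑ x ∈ s.biUnion B, f x ≤ ∑ i ∈ s, ∑ x ∈ B i, f x := by
  classical
  induction s using Finset.induction_on with
  | empty => simp
  | insert a s ha ih =>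
    rw [Finset.biUnion_insert, Finset.sum_insert ha]
    exact (sum_union_le_of_nonneg hf _ _).trans (by gcongr)

variable {ι : Type*} [Fintype ι] {α : ι → ℝ}

/-- Chernoff's bound: a sum of independent variables of negative mean is exponentially unlikely
to be nonnegative. -/
theorem exists_sum_prod_le_pow (hα : α ∈ stdSimplex ℝ ι) {z : ι → ℝ} (hz : ∑ i, α i * z i < 0) :
    ∃ r : ℝ, 0 ≤ r ∧ r < 1 ∧ ∀ (n : ℕ) (B : Finset (Fin n → ι)),
      (∀ s ∈ B, 0 ≤ ∑ i, z (s i)) → ∑ s ∈ B, ∏ i, α (s i) ≤ r ^ n := by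
  -- The moment generating function equals 1 at 0 and has the negative mean as its derivative there,
  -- so it is below 1 at some `t > 0`.
  have hd : HasDerivAt (fun t : ℝ => ∑ i, α i * Real.exp (t * z i)) (∑ i, α i * z i) 0 := by
    refine HasDerivAt.fun_sum fun i _ => ?_
    have := (((hasDerivAt_id (0 : ℝ)).mul_const (z i)).exp).const_mul (α i)
    simpa using this
  have h0 : (fun t : ℝ => ∑ i, α i * Real.exp (t * z i)) 0 = 1 := by simp [hα.2]
  obtain ⟨t, ht, htlt⟩ : ∃ t : ℝ, 0 < t ∧ ∑ i, α i * Real.exp (t * z i) < 1 := by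
    have h1 := (hasDerivAt_iff_tendsto_slope_zero.1 hd).eventually (gt_mem_nhds hz)
    have h2 : ∀ᶠ t : ℝ in 𝓝[>] 0, t⁻¹ • ((fun t : ℝ => ∑ i, α i * Real.exp (t * z i)) (0 + t) -
        (fun t : ℝ => ∑ i, α i * Real.exp (t * z i)) 0) < 0 :=
      h1.filter_mono (nhdsWithin_mono _ fun t ht => (ne_of_gt ht))
    obtain ⟨t, h3, ht⟩ := (h2.and self_mem_nhdsWithin).exists
    refine ⟨t, ht, ?_⟩
    rw [h0, zero_add, smul_eq_mul] at h3
    have := (pos_iff_neg_of_mul_neg h3).1 (inv_pos.2 ht)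
    exact sub_neg.1 this
  have hnn : ∀ i, 0 ≤ α i * Real.exp (t * z i) := fun i => mul_nonneg (hα.1 i) (Real.exp_nonneg _)
  refine ⟨_, Finset.sum_nonneg fun i _ => hnn i, htlt, fun n B hB => ?_⟩
  rw [Fintype.sum_pow]
  refine (Finset.sum_le_sum fun s hs => ?_).trans
    (Finset.sum_le_univ_sum_of_nonneg fun s => Finset.prod_nonneg fun i _ => hnn _)
  rw [Finset.prod_mul_distrib, ← Real.exp_sum, ← Finset.mul_sum]
  refine le_mul_of_one_le_right (Finset.prod_nonneg fun i _ => hα.1 _) ?_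
  exact Real.one_le_exp (mul_nonneg ht.le (hB s hs))

/-- Here `r` is the weight of `p`, which is below 1 because it misses `i₀`. This makes non-injective
maps exponentially unlikely. -/
theorem exists_sum_prod_le_pow_of_exists (hα : α ∈ stdSimplex ℝ ι) {p : ι → Prop} {i₀ : ι}
    (hi : 0 < α i₀) (hp : ¬ p i₀) :
    ∃ r : ℝ, 0 ≤ r ∧ r < 1 ∧ ∀ (n : ℕ) (B : Finset (Fin n → ι)),
      (∀ s ∈ B, ∀ i, p (s i)) → ∑ s ∈ B, ∏ i, α (s i) ≤ r ^ n := by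
  classical
  have hnn : ∀ i, 0 ≤ if p i then α i else 0 := fun i => by split_ifs <;> simp [hα.1]
  refine ⟨∑ i, if p i then α i else 0, Finset.sum_nonneg fun i _ => hnn i, ?_, fun n B hB => ?_⟩
  · rw [← hα.2]
    refine Finset.sum_lt_sum (fun i _ => by split_ifs <;> simp [hα.1]) ⟨i₀, Finset.mem_univ _, ?_⟩
    simpa [hp] using hi
  · rw [Fintype.sum_pow]
    refine (Finset.sum_le_sum fun s hs => ?_).trans
      (Finset.sum_le_univ_sum_of_nonneg fun s => Finset.prod_nonneg fun i _ => hnn _)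
    exact le_of_eq (Finset.prod_congr rfl fun i _ => (if_pos (hB s hs i)).symm)

end Chernoff

/-! ### Typical sequences and their weight -/

section SecondMoment

variable {P : Type*} [PartialOrder P] [Fintype P]

/-- The antichains of `P`, the index set of its weightings. -/
abbrev Antichain (P : Type*) [PartialOrder P] [Fintype P] : Type _ :=
  antichains (Finset.univ : Finset P)

theorem continuous_relExponent (Q : Finset P) :
    Continuous fun α : Antichain P → ℝ => relExponent α Q := by
  unfold relExponent inducedWeight
  refine Continuous.div_const (continuous_finsetSum _ fun T _ =>
    Real.continuous_negMulLog.comp (continuous_finsetSum _ fun S _ => ?_)) _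
  split_ifs
  · exact continuous_apply S
  · exact continuous_const

/-- A near-optimal weighting is mixed with a little of the uniform one; by continuity the strict
inequalities survive. Positivity is what later separates any two elements of `P`. -/
theorem exists_pos_weights {c : ℝ} (hc0 : 0 ≤ c) (hc : c < cStar P) :
    ∃ d, c < d ∧ ∃ α ∈ stdSimplex ℝ (Antichain P), (∀ S, 0 < α S) ∧
      ∀ Q : Finset P, Q.Nonempty → d < relExponent α Q := by
  have hne : {c : ℝ | 0 ≤ c ∧ ∃ α ∈ stdSimplex ℝ (Antichain P),
      ∀ Q : Finset P, Q.Nonempty → c ≤ relExponent α Q}.Nonempty := by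
    by_contra h
    rw [cStar, Set.not_nonempty_iff_eq_empty.1 h, Real.sSup_empty] at hc
    exact hc.not_ge hc0
  obtain ⟨b, ⟨-, α, hα, hb⟩, hcb⟩ := exists_lt_of_lt_csSup hne hc
  obtain ⟨d, hcd, hdb⟩ := exists_between hcb
  have : Nonempty (Antichain P) := ⟨⟨_, shadow_mem_antichains Finset.univ ∅⟩⟩
  set N : ℝ := (Fintype.card (Antichain P) : ℝ)
  have hN : 0 < N := Nat.cast_pos.2 Fintype.card_pos
  set γ : ℝ → Antichain P → ℝ := fun ε S => (1 - ε) * α S + ε * N⁻¹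
  have hγ : Continuous γ := by fun_prop
  have hev : ∀ᶠ ε in 𝓝 (0 : ℝ), ∀ Q : Finset P, Q.Nonempty → d < relExponent (γ ε) Q := by
    rw [eventually_all]
    intro Q
    by_cases hQ : Q.Nonempty
    · have h0 : γ 0 = α := by ext S; simp [γ]
      have := ((continuous_relExponent Q).comp hγ).continuousAt (x := 0)
      refine (this.eventually (lt_mem_nhds (a := d) ?_)).mono fun ε h _ => h
      simp only [Function.comp, h0]
      exact hdb.trans_le (hb Q hQ)
    · exact Eventually.of_forall fun _ h => absurd h hQ
  have hev' : ∀ᶠ ε in 𝓝[>] (0 : ℝ), ε < 1 :=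
    (gt_mem_nhds one_pos).filter_mono nhdsWithin_le_nhds
  obtain ⟨ε, ⟨h1, h2⟩, h3⟩ := (((hev.filter_mono nhdsWithin_le_nhds).and hev').and
    self_mem_nhdsWithin).exists
  have h3 : 0 < ε := h3
  refine ⟨d, hcd, γ ε, ⟨fun S => ?_, ?_⟩, fun S => ?_, h1⟩
  · have := hα.1 S
    have : 0 ≤ 1 - ε := by linarith
    positivity
  · simp only [γ, Finset.sum_add_distrib, ← Finset.mul_sum, hα.2, Finset.sum_const,
      Finset.card_univ, nsmul_eq_mul]
    change (1 - ε) * 1 + ε * (N * N⁻¹) = 1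
    rw [mul_inv_cancel₀ hN.ne']
    ring
  · have := hα.1 S
    have : 0 ≤ 1 - ε := by linarith
    positivity

variable [DecidableLE P]

/-- The sequence `s` encodes an injective map, and every restriction of it has probability at most
`exp (-(d * n * |Q|))` under the product of the weights `α`. -/
def Typical (α : Antichain P → ℝ) (d : ℝ) {n : ℕ} (s : Fin n → Antichain P) : Prop :=
  Function.Injective (decode fun i => (s i).1) ∧ ∀ Q : Finset P, Q.Nonempty →
    ∏ i, marg α (fun S => shadow Q S.1) (shadow Q (s i).1) ≤ Real.exp (-(n * (Q.card * d)))

-- Typicality fails through finitely many events, each exponentially unlikely: for a set `Q`, by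
-- Chernoff's bound, since `log` of the marginal has mean `-|Q|` times the exponent, below `-|Q| d`;
-- for a pair of elements, because some antichain separates them.
open Classical in
theorem tendsto_sum_typical {α : Antichain P → ℝ} (hα : α ∈ stdSimplex ℝ _)
    (hpos : ∀ S, 0 < α S) {d : ℝ} (hd : ∀ Q : Finset P, Q.Nonempty → d < relExponent α Q) :
    Tendsto (fun n : ℕ => ∑ s : Fin n → Antichain P with Typical α d s, ∏ i, α (s i))
      atTop (𝓝 1) := by
  have hQ : ∀ Q : Finset P, ∃ r : ℝ, 0 ≤ r ∧ r < 1 ∧ ∀ (n : ℕ) (B : Finset (Fin n → Antichain P)),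
      (∀ s ∈ B, Q.Nonempty ∧ ¬ ∏ i, marg α (fun S => shadow Q S.1) (shadow Q (s i).1) ≤
        Real.exp (-(n * (Q.card * d)))) → ∑ s ∈ B, ∏ i, α (s i) ≤ r ^ n := by
    intro Q
    rcases Q.eq_empty_or_nonempty with h0 | hQ
    · refine ⟨0, le_rfl, one_pos, fun n B hB => ?_⟩
      have : B = ∅ := Finset.eq_empty_of_forall_notMem fun s hs => by
        simpa [h0] using (hB s hs).1
      rw [this, Finset.sum_empty]
      positivity
    · have hcard : (0 : ℝ) < Q.card := by exact_mod_cast hQ.card_pos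
      have hmean : ∑ S, α S * (Real.log (marg α (fun S => shadow Q S.1) (shadow Q S.1)) +
          Q.card * d) < 0 := by
        simp only [mul_add, Finset.sum_add_distrib, ← Finset.sum_mul, hα.2]
        have := hd Q hQ
        rw [relExponent_eq_ent, lt_div_iff₀ hcard, ent] at this
        linarith
      obtain ⟨r, h0, h1, h2⟩ := exists_sum_prod_le_pow hα hmean
      refine ⟨r, h0, h1, fun n B hB => h2 n B fun s hs => ?_⟩
      have h3 := not_le.1 (hB s hs).2
      have h4 : ∀ i, 0 < marg α (fun S : Antichain P => shadow Q S.1) (shadow Q (s i).1) :=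
        fun i => marg_pos hα.1 (fun S : Antichain P => shadow Q S.1) (hpos (s i))
      rw [← Real.lt_log_iff_exp_lt (Finset.prod_pos fun i _ => h4 i),
        Real.log_prod fun i _ => (h4 i).ne'] at h3
      rw [Finset.sum_add_distrib, Finset.sum_const, Finset.card_univ, Fintype.card_fin,
        nsmul_eq_mul]
      linarith
  have hxy : ∀ x : P × P, ∃ r : ℝ, 0 ≤ r ∧ r < 1 ∧
      ∀ (n : ℕ) (B : Finset (Fin n → Antichain P)),
      (∀ s ∈ B, x.1 ≠ x.2 ∧ decode (fun i => (s i).1) x.1 = decode (fun i => (s i).1) x.2) →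
        ∑ s ∈ B, ∏ i, α (s i) ≤ r ^ n := by
    rintro ⟨x, y⟩
    by_cases hne : x = y
    · refine ⟨0, le_rfl, one_pos, fun n B hB => ?_⟩
      have : B = ∅ := Finset.eq_empty_of_forall_notMem fun s hs => (hB s hs).1 hne
      rw [this, Finset.sum_empty]
      positivity
    · obtain ⟨S, hS⟩ : ∃ S : Antichain P, ¬ ((∃ z ∈ S.1, z ≤ x) ↔ ∃ z ∈ S.1, z ≤ y) := by
        have hsing : ∀ z : P, {z} ∈ antichains (Finset.univ : Finset P) := fun z =>
          mem_antichains.2 ⟨Finset.subset_univ _, by simp⟩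
        by_cases hle : x ≤ y
        · refine ⟨⟨{y}, hsing y⟩, ?_⟩
          simpa using fun h => hne (le_antisymm hle h)
        · exact ⟨⟨{x}, hsing x⟩, by simpa using hle⟩
      obtain ⟨r, h0, h1, h2⟩ := exists_sum_prod_le_pow_of_exists hα (hpos S)
        (p := fun S => (∃ z ∈ S.1, z ≤ x) ↔ ∃ z ∈ S.1, z ≤ y) hS
      refine ⟨r, h0, h1, fun n B hB => h2 n B fun s hs i => ?_⟩
      rw [← mem_decode (u := fun i => (s i).1), ← mem_decode (u := fun i => (s i).1),
        (hB s hs).2]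
  choose r hr0 hr1 hr using hQ
  choose q hq0 hq1 hq using hxy
  have hnn : ∀ (n : ℕ) (s : Fin n → Antichain P), 0 ≤ ∏ i, α (s i) := fun n s =>
    Finset.prod_nonneg fun i _ => hα.1 _
  have htot : ∀ n : ℕ, ∑ s : Fin n → Antichain P, ∏ i, α (s i) = 1 := fun n => by
    rw [← Fintype.sum_pow, hα.2, one_pow]
  have hlow : ∀ n : ℕ, 1 - (∑ Q, r Q ^ n + ∑ x, q x ^ n) ≤
      ∑ s : Fin n → Antichain P with Typical α d s, ∏ i, α (s i) := by
    intro n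
    set BQ : Finset P → Finset (Fin n → Antichain P) := fun Q => Finset.univ.filter fun s =>
      Q.Nonempty ∧ ¬ ∏ i, marg α (fun S => shadow Q S.1) (shadow Q (s i).1) ≤
        Real.exp (-(n * (Q.card * d)))
    set Bx : P × P → Finset (Fin n → Antichain P) := fun x => Finset.univ.filter fun s =>
      x.1 ≠ x.2 ∧ decode (fun i => (s i).1) x.1 = decode (fun i => (s i).1) x.2
    have hcover : (Finset.univ.filter fun s : Fin n → Antichain P => ¬ Typical α d s) ⊆
        Finset.univ.biUnion BQ ∪ Finset.univ.biUnion Bx := by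
      intro s hs
      have hs := (Finset.mem_filter.1 hs).2
      by_contra hcon
      refine hs ⟨fun x y hxy => ?_, fun Q hQ => ?_⟩
      · by_contra hne
        exact hcon (Finset.mem_union_right _ (Finset.mem_biUnion.2 ⟨(x, y), Finset.mem_univ _,
          Finset.mem_filter.2 ⟨Finset.mem_univ _, hne, hxy⟩⟩))
      · by_contra hne
        exact hcon (Finset.mem_union_left _ (Finset.mem_biUnion.2 ⟨Q, Finset.mem_univ _,
          Finset.mem_filter.2 ⟨Finset.mem_univ _, hQ, hne⟩⟩))
    have hbad : ∑ s : Fin n → Antichain P with ¬ Typical α d s, ∏ i, α (s i) ≤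
        ∑ Q, r Q ^ n + ∑ x, q x ^ n := by
      refine (Finset.sum_le_sum_of_subset_of_nonneg hcover fun s _ _ => hnn n s).trans ?_
      refine (sum_union_le_of_nonneg (hnn n) _ _).trans (add_le_add ?_ ?_)
      · refine (sum_biUnion_le_of_nonneg (hnn n) _ _).trans (Finset.sum_le_sum fun Q _ => ?_)
        exact hr Q n _ fun s hs => (Finset.mem_filter.1 hs).2
      · refine (sum_biUnion_le_of_nonneg (hnn n) _ _).trans (Finset.sum_le_sum fun x _ => ?_)
        exact hq x n _ fun s hs => (Finset.mem_filter.1 hs).2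
    have := Finset.sum_filter_add_sum_filter_not Finset.univ
      (fun s : Fin n → Antichain P => Typical α d s) fun s => ∏ i, α (s i)
    rw [htot] at this
    linarith
  have hup : ∀ n : ℕ, ∑ s : Fin n → Antichain P with Typical α d s, ∏ i, α (s i) ≤ 1 := fun n => by
    rw [← htot n]
    exact Finset.sum_le_sum_of_subset_of_nonneg (Finset.subset_univ _) fun s _ _ => hnn n s
  refine tendsto_of_tendsto_of_tendsto_of_le_of_le ?_ tendsto_const_nhds hlow hup
  have h1 : Tendsto (fun n : ℕ => ∑ Q, r Q ^ n) atTop (𝓝 0) := by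
    simpa using tendsto_finsetSum Finset.univ fun Q _ =>
      tendsto_pow_atTop_nhds_zero_of_lt_one (hr0 Q) (hr1 Q)
  have h2 : Tendsto (fun n : ℕ => ∑ x, q x ^ n) atTop (𝓝 0) := by
    simpa using tendsto_finsetSum Finset.univ fun x _ =>
      tendsto_pow_atTop_nhds_zero_of_lt_one (hq0 x) (hq1 x)
  simpa using (h1.add h2).const_sub 1

-- All sequences with prescribed values on `Q` share their shadows in `Q`. Their total weight is
-- thus at most the product of marginals of any one of them, which typicality bounds.
open Classical in
theorem sum_typical_le {α : Antichain P → ℝ} (hα : α ∈ stdSimplex ℝ _) {d : ℝ} {n : ℕ}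
    {Q : Finset P} (hQ : Q.Nonempty) (ψ : P → Finset (Fin n)) :
    ∑ t : Fin n → Antichain P with
      Typical α d t ∧ ∀ x ∈ Q, decode (fun i => (t i).1) x = ψ x, ∏ i, α (t i) ≤
      Real.exp (-(n * (Q.card * d))) := by
  rcases (Finset.univ.filter fun t : Fin n → Antichain P =>
      Typical α d t ∧ ∀ x ∈ Q, decode (fun i => (t i).1) x = ψ x).eq_empty_or_nonempty
    with h0 | ⟨t₀, ht₀⟩
  · rw [h0, Finset.sum_empty]
    exact Real.exp_nonneg _
  obtain ⟨-, htyp, hψ⟩ := Finset.mem_filter.1 ht₀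
  refine le_trans ?_ (htyp.2 Q hQ)
  have : ∏ i, marg α (fun S => shadow Q S.1) (shadow Q (t₀ i).1) =
      ∏ i, ∑ S : Antichain P with shadow Q S.1 = shadow Q (t₀ i).1, α S :=
    Finset.prod_congr rfl fun i _ => by
      simp only [marg, Finset.sum_filter]
      congr!
  rw [this, Finset.prod_univ_sum]
  refine Finset.sum_le_sum_of_subset_of_nonneg (fun t ht => ?_) fun t _ _ =>
    Finset.prod_nonneg fun i _ => hα.1 _
  obtain ⟨-, -, hψt⟩ := Finset.mem_filter.1 ht
  rw [Fintype.mem_piFinset]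
  refine fun i => Finset.mem_filter.2 ⟨Finset.mem_univ _, shadow_eq_shadow_iff.2 fun x hx => ?_⟩
  rw [← mem_decode (u := fun i => (t i).1), ← mem_decode (u := fun i => (t₀ i).1), hψt x hx,
    hψ x hx]

end SecondMoment

/-! ### Overlapping pairs of copies, and existence of copies below the threshold -/

section SecondMoment

/-- The overlap of two copies, encoded by injections `f` and `g`, is detected by a function
`σ` matching a subset `Q` of the first copy with part of the second. -/
theorem pow_card_union_image_le {P β : Type*} [Fintype P] [DecidableEq β] [DecidableEq P]
    {f g : P → β} (hf : f.Injective) (hg : g.Injective) {p : ℝ} (hp : 0 < p) :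
    p ^ (Finset.univ.image f ∪ Finset.univ.image g).card ≤
      p ^ (2 * Fintype.card P) * (1 + ∑ Q : Finset P with Q.Nonempty, ∑ σ : P → P,
        if ∀ x ∈ Q, g x = f (σ x) then (p ^ Q.card)⁻¹ else 0) := by
  classical
  set Q : Finset P := Finset.univ.filter fun x => g x ∈ Finset.univ.image f
  have hQ : (Finset.univ.image f ∩ Finset.univ.image g).card = Q.card := by
    rw [← Finset.card_image_of_injective Q hg]
    congr 1
    ext b
    simp only [Finset.mem_inter, Finset.mem_image, Finset.mem_univ, true_and, Q,
      Finset.mem_filter]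
    constructor
    · rintro ⟨⟨x, rfl⟩, y, hy⟩
      exact ⟨y, ⟨x, hy.symm⟩, hy⟩
    · rintro ⟨y, ⟨x, hx⟩, rfl⟩
      exact ⟨⟨x, hx⟩, y, rfl⟩
  have hcard := Finset.card_union_add_card_inter (Finset.univ.image f) (Finset.univ.image g)
  rw [hQ, Finset.card_image_of_injective _ hf, Finset.card_image_of_injective _ hg,
    Finset.card_univ, ← two_mul] at hcard
  have hterm : ∀ Q : Finset P, ∀ σ : P → P,
      0 ≤ if ∀ x ∈ Q, g x = f (σ x) then (p ^ Q.card)⁻¹ else 0 := fun Q σ => by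
    split_ifs <;> positivity
  -- The summand 1 covers disjoint images; otherwise the actual overlap and its matching form one of
  -- the nonnegative terms.
  have hsum : (p ^ Q.card)⁻¹ ≤ 1 + ∑ Q : Finset P with Q.Nonempty, ∑ σ : P → P,
      if ∀ x ∈ Q, g x = f (σ x) then (p ^ Q.card)⁻¹ else 0 := by
    rcases Q.eq_empty_or_nonempty with h0 | h0
    · rw [h0, Finset.card_empty, pow_zero, inv_one]
      exact le_add_of_nonneg_right (Finset.sum_nonneg fun Q _ =>
        Finset.sum_nonneg fun σ _ => hterm Q σ)
    · have : ∀ x, ∃ y, x ∈ Q → g x = f y := fun x => by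
        by_cases hx : x ∈ Q
        · obtain ⟨y, -, hy⟩ := Finset.mem_image.1 (Finset.mem_filter.1 hx).2
          exact ⟨y, fun _ => hy.symm⟩
        · exact ⟨x, fun h => absurd h hx⟩
      choose σ hσ using this
      have h1 := Finset.single_le_sum (f := fun Q : Finset P => ∑ σ : P → P,
        if ∀ x ∈ Q, g x = f (σ x) then (p ^ Q.card)⁻¹ else 0)
        (fun Q _ => Finset.sum_nonneg fun σ _ => hterm Q σ)
        (Finset.mem_filter.2 ⟨Finset.mem_univ Q, h0⟩)
      have h2 := Finset.single_le_sum (f := fun σ : P → P =>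
        if ∀ x ∈ Q, g x = f (σ x) then (p ^ Q.card)⁻¹ else 0)
        (fun σ _ => hterm Q σ) (Finset.mem_univ σ)
      simp only [if_pos hσ] at h2
      linarith [h2.trans h1]
  calc p ^ (Finset.univ.image f ∪ Finset.univ.image g).card
      = p ^ (2 * Fintype.card P) * (p ^ Q.card)⁻¹ := by
        rw [← hcard, pow_add, mul_inv_cancel_right₀ (by positivity)]
    _ ≤ _ := by gcongr

variable {P : Type*} [PartialOrder P] [Fintype P]

-- For fixed `Q` and `σ` the values of `t` on `Q` are prescribed. The weight of such `t` is at most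
-- `exp (-(d * n * |Q|))`, against a gain of only `exp (c * n * |Q|)` from the shared elements.
open Classical in
theorem sum_overlap_le {α : Antichain P → ℝ} (hα : α ∈ stdSimplex ℝ _) {c d : ℝ} (hcd : c < d)
    {n : ℕ} (g : P → Finset (Fin n)) :
    ∑ t : Fin n → Antichain P with Typical α d t, (∏ i, α (t i)) *
      ∑ Q : Finset P with Q.Nonempty, ∑ σ : P → P,
        (if ∀ x ∈ Q, decode (fun i => (t i).1) x = g (σ x) then
          (Real.exp (-(c * n)) ^ Q.card)⁻¹ else 0) ≤
      Fintype.card (Finset P) * Fintype.card (P → P) * Real.exp (-((d - c) * n)) := by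
  simp only [Finset.mul_sum]
  rw [Finset.sum_comm]
  have hQ : ∀ Q ∈ (Finset.univ : Finset (Finset P)).filter Finset.Nonempty,
      ∑ t : Fin n → Antichain P with Typical α d t, ∑ σ : P → P, (∏ i, α (t i)) *
        (if ∀ x ∈ Q, decode (fun i => (t i).1) x = g (σ x) then
          (Real.exp (-(c * n)) ^ Q.card)⁻¹ else 0) ≤
        Fintype.card (P → P) * Real.exp (-((d - c) * n)) := by
    intro Q hQ
    have hQ := (Finset.mem_filter.1 hQ).2
    rw [Finset.sum_comm, ← nsmul_eq_mul]
    refine Finset.sum_le_card_nsmul _ _ _ fun σ _ => ?_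
    have h1 := sum_typical_le (d := d) hα hQ fun x => g (σ x)
    rw [← Finset.filter_filter, Finset.sum_filter] at h1
    have h2 := mul_le_mul_of_nonneg_right h1
      (inv_nonneg.2 (pow_nonneg (Real.exp_nonneg (-(c * n))) Q.card))
    rw [Finset.sum_mul] at h2
    simp only [ite_mul, zero_mul] at h2
    simp only [mul_ite, mul_zero]
    refine h2.trans ?_
    rw [← Real.exp_nat_mul, ← Real.exp_neg, ← Real.exp_add, Real.exp_le_exp]
    have hQ1 : (1 : ℝ) ≤ Q.card := by exact_mod_cast hQ.card_pos
    have : 0 ≤ (d - c) * n := mul_nonneg (sub_pos.2 hcd).le (Nat.cast_nonneg n)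
    nlinarith
  refine (Finset.sum_le_card_nsmul _ _ _ hQ).trans ?_
  rw [nsmul_eq_mul, ← mul_assoc]
  gcongr
  exact Finset.card_le_univ _

open Classical in
/-- The quantitative second moment bound. -/
theorem sq_sum_typical_le {α : Antichain P → ℝ} (hα : α ∈ stdSimplex ℝ _) {c d : ℝ} (hc0 : 0 ≤ c)
    (hcd : c < d) (n : ℕ) :
    (∑ s : Fin n → Antichain P with Typical α d s, ∏ i, α (s i)) ^ 2 ≤
      (law n (retention c n)).real {S | HasCopy P S} *
        ((∑ s : Fin n → Antichain P with Typical α d s, ∏ i, α (s i)) ^ 2 +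
          Fintype.card (Finset P) * Fintype.card (P → P) * Real.exp (-((d - c) * n))) := by
  set m := ∑ s : Fin n → Antichain P with Typical α d s, ∏ i, α (s i)
  set μ := law n (retention c n)
  set p := Real.exp (-(c * n)) with hp
  have hp0 : 0 < p := Real.exp_pos _
  set k := Fintype.card P
  set K : ℝ := Fintype.card (Finset P) * Fintype.card (P → P)
  set τ := {s : Fin n → Antichain P // Typical α d s}
  set w : τ → ℝ := fun s => ∏ i, α (s.1 i)
  have hw0 : ∀ s, 0 ≤ w s := fun s => Finset.prod_nonneg fun i _ => hα.1 _
  set f : τ → P → Finset (Fin n) := fun s => decode fun i => (s.1 i).1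
  have hf : ∀ s, (f s).Injective := fun s => s.2.1
  have hsub : ∀ G : (Fin n → Antichain P) → ℝ, ∑ s : τ, G s.1 = ∑ s with Typical α d s, G s :=
    fun G => (Finset.sum_subtype _ (fun s => by simp) G).symm
  have hm : ∑ s, w s = m := hsub fun s => ∏ i, α (s i)
  have hm1 : m ≤ 1 := by
    refine (Finset.sum_le_univ_sum_of_nonneg fun s => Finset.prod_nonneg fun i _ => hα.1 _).trans ?_
    rw [← Fintype.sum_pow, hα.2, one_pow]
  -- The second moment is taken of the sum of `w s` over those typical `s` whose copy is retained.
  set E : τ → Set (Set (Finset (Fin n))) := fun s => {S | ∀ a ∈ Finset.univ.image (f s), a ∈ S}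
  have hE : ∀ s, μ.real (E s) = p ^ k := fun s => by
    rw [law_real_superset, coe_retention hc0, Finset.card_image_of_injective _ (hf s),
      Finset.card_univ]
  have hEE : ∀ s t, μ.real (E s ∩ E t) ≤ p ^ (2 * k) * (1 +
      ∑ Q : Finset P with Q.Nonempty, ∑ σ : P → P,
        if ∀ x ∈ Q, f t x = f s (σ x) then (p ^ Q.card)⁻¹ else 0) := fun s t => by
    have : E s ∩ E t = {S | ∀ a ∈ Finset.univ.image (f s) ∪ Finset.univ.image (f t), a ∈ S} := by
      ext S
      simp only [E, Finset.mem_union, or_imp, forall_and]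
      rfl
    rw [this, law_real_superset, coe_retention hc0]
    exact pow_card_union_image_le (hf s) (hf t) hp0
  have hcopy : (⋃ s, E s) ⊆ {S | HasCopy P S} := by
    refine Set.iUnion_subset fun s S hS => ⟨fun x => ⟨f s x, hS _ ?_⟩, fun x y hxy => ?_, ?_⟩
    · exact Finset.mem_image_of_mem _ (Finset.mem_univ x)
    · exact hf s (congrArg Subtype.val hxy)
    · intro x y hxy
      have : f s x ≤ f s y := decode_mono (fun i => (s.1 i).1) hxy
      exact this
  have hover : ∀ s, ∑ t, w t * ∑ Q : Finset P with Q.Nonempty, ∑ σ : P → P,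
      (if ∀ x ∈ Q, f t x = f s (σ x) then (p ^ Q.card)⁻¹ else 0) ≤
        K * Real.exp (-((d - c) * n)) := fun s =>
    (hsub fun t => (∏ i, α (t i)) * ∑ Q : Finset P with Q.Nonempty, ∑ σ : P → P,
      if ∀ x ∈ Q, decode (fun i => (t i).1) x = f s (σ x) then (p ^ Q.card)⁻¹ else 0).trans_le
      (sum_overlap_le hα hcd (f s))
  have hsecond : ∑ s, ∑ t, w s * w t * μ.real (E s ∩ E t) ≤
      p ^ (2 * k) * (m ^ 2 + K * Real.exp (-((d - c) * n))) := by
    have hs : ∀ s ∈ (Finset.univ : Finset τ), ∑ t, w s * w t * μ.real (E s ∩ E t) ≤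
        w s * (p ^ (2 * k) * (m + K * Real.exp (-((d - c) * n)))) := by
      intro s _
      simp only [mul_assoc]
      rw [← Finset.mul_sum]
      refine mul_le_mul_of_nonneg_left ?_ (hw0 s)
      refine (Finset.sum_le_sum fun t _ => mul_le_mul_of_nonneg_left (hEE s t) (hw0 t)).trans ?_
      simp only [mul_left_comm (w _) (p ^ (2 * k))]
      rw [← Finset.mul_sum]
      refine mul_le_mul_of_nonneg_left ?_ (by positivity)
      simp only [mul_add, mul_one, Finset.sum_add_distrib, hm]
      gcongr
      exact hover s
    refine (Finset.sum_le_sum hs).trans ?_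
    rw [← Finset.sum_mul, hm]
    have hK : 0 ≤ K * Real.exp (-((d - c) * n)) := by positivity
    have hpk : 0 < p ^ (2 * k) := by positivity
    calc m * (p ^ (2 * k) * (m + K * Real.exp (-((d - c) * n))))
        = p ^ (2 * k) * (m ^ 2 + m * (K * Real.exp (-((d - c) * n)))) := by ring
      _ ≤ _ := mul_le_mul_of_nonneg_left
        (add_le_add le_rfl (mul_le_of_le_one_left hK hm1)) hpk.le
  have key := sq_sum_le_measure_iUnion μ E (w := w)
  simp only [hE] at key
  rw [← Finset.sum_mul, hm, mul_pow, ← pow_mul, mul_comm k 2] at key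
  have hpk : 0 < p ^ (2 * k) := by positivity
  have h1 : m ^ 2 * p ^ (2 * k) ≤ μ.real {S | HasCopy P S} *
      (p ^ (2 * k) * (m ^ 2 + K * Real.exp (-((d - c) * n)))) :=
    key.trans (mul_le_mul (measureReal_mono hcopy (measure_ne_top _ _)) hsecond
      (Finset.sum_nonneg fun s _ => Finset.sum_nonneg fun t _ =>
        mul_nonneg (mul_nonneg (hw0 s) (hw0 t)) measureReal_nonneg) measureReal_nonneg)
  rw [mul_left_comm, mul_comm] at h1
  exact le_of_mul_le_mul_left h1 hpk

/-- Below the critical exponent there is a copy with high probability. -/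
theorem whp_hasCopy {c : ℝ} (hc0 : 0 ≤ c) (hc : c < cStar P) :
    WHP c fun _ S => HasCopy P S := by
  classical
  obtain ⟨d, hcd, α, hα, hpos, hd⟩ := exists_pos_weights hc0 hc
  have hm := tendsto_sum_typical hα hpos hd
  rw [whp_iff_real]
  set m : ℕ → ℝ := fun n => ∑ s : Fin n → Antichain P with Typical α d s, ∏ i, α (s i)
  set K : ℝ := Fintype.card (Finset P) * Fintype.card (P → P)
  have he : Tendsto (fun n : ℕ => K * Real.exp (-((d - c) * n))) atTop (𝓝 0) := by
    have h1 := Real.tendsto_exp_neg_atTop_nhds_zero.comp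
      (tendsto_natCast_atTop_atTop.const_mul_atTop (sub_pos.2 hcd))
    simpa using h1.const_mul K
  have hlim : Tendsto (fun n : ℕ => m n ^ 2 / (m n ^ 2 + K * Real.exp (-((d - c) * n))))
      atTop (𝓝 1) := by
    simpa [Pi.div_def] using (hm.pow 2).div ((hm.pow 2).add he) (by norm_num)
  refine tendsto_of_tendsto_of_tendsto_of_le_of_le hlim tendsto_const_nhds (fun n => ?_)
    fun n => measureReal_le_one
  have hK : 0 ≤ K * Real.exp (-((d - c) * n)) := by positivity
  exact div_le_of_le_mul₀ (by positivity) measureReal_nonneg (sq_sum_typical_le hα hc0 hcd n)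

end SecondMoment

/-! ### Ramsey properties and diamonds -/

section Ramsey

variable {R : Type*} [PartialOrder R]

theorem HasCopy.ramseyPair {P Q F : Type*} [PartialOrder P] [PartialOrder Q] [PartialOrder F]
    (hF : IsRamseyPair P Q F) (h : HasCopy F R) : IsRamseyPair P Q R := by
  obtain ⟨φ, hφ, hmono⟩ := h
  intro χ
  rcases hF (χ ∘ φ) with ⟨ψ, h1, h2, h3⟩ | ⟨ψ, h1, h2, h3⟩
  · exact Or.inl ⟨φ ∘ ψ, hφ.comp h1, hmono.comp h2, h3⟩
  · exact Or.inr ⟨φ ∘ ψ, hφ.comp h1, hmono.comp h2, h3⟩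

theorem isRamsey_two_iff {F : Type*} [PartialOrder F] : IsRamsey F 2 R ↔ IsRamseyPair F F R :=
  forall_congr' fun χ => by simp [Fin.exists_fin_two]

theorem IsRamseyPair.mono {P Q α : Type*} [PartialOrder P] [PartialOrder Q] [PartialOrder α]
    {S S' : Set α} (h : S ⊆ S') (hS : IsRamseyPair P Q S) : IsRamseyPair P Q S' :=
  HasCopy.ramseyPair hS ⟨Set.inclusion h, Set.inclusion_injective h, fun _ _ h => h⟩

/-- `a < b, c < d` with `b ≠ c`. -/
def IsDiamond (a b c d : R) : Prop := a < b ∧ a < c ∧ b < d ∧ c < d ∧ b ≠ c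

theorem hasMonoCopy_diamond_iff {K : Type*} {χ : R → K} {i : K} :
    HasMonoCopy (F := Finset (Fin 2)) χ i ↔
      ∃ a b c d, IsDiamond a b c d ∧ χ a = i ∧ χ b = i ∧ χ c = i ∧ χ d = i := by
  constructor
  · rintro ⟨φ, hinj, hmono, hχ⟩
    have hlt : ∀ s t : Finset (Fin 2), s < t → φ s < φ t := fun s t h =>
      (hmono.strictMono_of_injective hinj) h
    refine ⟨φ ∅, φ {0}, φ {1}, φ {0, 1}, ⟨hlt _ _ ?_, hlt _ _ ?_, hlt _ _ ?_, hlt _ _ ?_,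
      hinj.ne ?_⟩, hχ _, hχ _, hχ _, hχ _⟩ <;> decide
  · rintro ⟨a, b, c, d, ⟨hab, hac, hbd, hcd, hbc⟩, ha, hb, hc, hd⟩
    refine ⟨fun s => if 0 ∈ s then (if 1 ∈ s then d else b) else (if 1 ∈ s then c else a),
      ?_, ?_, fun s => ?_⟩
    · intro s t h
      have : ∀ s t : Finset (Fin 2), (0 ∈ s ↔ 0 ∈ t) → (1 ∈ s ↔ 1 ∈ t) → s = t := by decide
      have h1 := hab.ne; have h2 := hac.ne; have h3 := hbd.ne; have h4 := hcd.ne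
      have h5 := (hab.trans hbd).ne
      apply this
      all_goals
        simp only at h
        split_ifs at h <;> simp_all
    · intro s t h
      have h1 := hab.le; have h2 := hac.le; have h3 := hbd.le; have h4 := hcd.le
      have h5 := h1.trans h3
      have h0 : 0 ∈ s → 0 ∈ t := fun x => h x
      have h1' : 1 ∈ s → 1 ∈ t := fun x => h x
      simp only
      split_ifs <;> simp_all
    · simp only
      split_ifs <;> assumption

/-- Colour 1 goes to the tops of diamonds. A diamond in colour 0 would have a top of colour 1; in a
diamond of colour 1 the bottom is itself the top of a diamond, and the two stack to `C(1,2,1,2,1)`.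
-/
theorem not_ramsey_of_not_hasCopy (h : ¬ HasCopy (Levels ![1, 2, 1, 2, 1]) R) :
    ¬ IsRamseyPair (Finset (Fin 2)) (Finset (Fin 2)) R := by
  classical
  intro hR
  rcases hR fun x => if ∃ a b c, IsDiamond a b c x then 1 else 0 with hχ | hχ
  · obtain ⟨a, b, c, d, hd, -, -, -, hcol⟩ := hasMonoCopy_diamond_iff.1 hχ
    simp only [ite_eq_right_iff, one_ne_zero, imp_false] at hcol
    exact hcol ⟨a, b, c, hd⟩
  · obtain ⟨a, b, c, d, ⟨hab, hac, hbd, hcd, hbc⟩, hcol, -⟩ := hasMonoCopy_diamond_iff.1 hχ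
    simp only [ite_eq_left_iff, zero_ne_one, imp_false, not_not] at hcol
    obtain ⟨e, f, g, hef, heg, hfa, hga, hfg⟩ := hcol
    -- One-element levels are written twice to make the table rectangular; injectivity is only
    -- claimed for valid column indices.
    set m : Fin 5 → Fin 2 → R := ![![e, e], ![f, g], ![a, a], ![b, c], ![d, d]]
    have hstep : ∀ (i : Fin 4) j j', m i.castSucc j < m i.succ j' := by
      intro i j j'
      fin_cases i <;> fin_cases j <;> fin_cases j' <;> assumption
    have hlt' : ∀ (k : ℕ) (i i' : Fin 5), i'.1 = i.1 + k + 1 → ∀ j j', m i j < m i' j' := by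
      intro k
      induction k with
      | zero =>
        intro i i' h j j'
        obtain ⟨i', hi'⟩ := i'
        obtain rfl : i' = i.1 + 1 := h
        exact hstep ⟨i, by omega⟩ j j'
      | succ k ih =>
        intro i i' h j j'
        obtain ⟨i', hi'⟩ := i'
        obtain rfl : i' = i.1 + k + 1 + 1 := h
        exact (ih i ⟨i.1 + k + 1, by omega⟩ rfl j j').trans (hstep ⟨i.1 + k + 1, by omega⟩ j' j')
    have hlt : ∀ (i i' : Fin 5) j j', i < i' → m i j < m i' j' := fun i i' j j' h =>
      hlt' (i'.1 - i.1 - 1) i i' (by have := Fin.lt_def.1 h; omega) j j'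
    have hne : ∀ (i : Fin 5) (j j' : Fin 2), j.1 < ![1, 2, 1, 2, 1] i → j'.1 < ![1, 2, 1, 2, 1] i →
        m i j = m i j' → j = j' := by
      intro i j j' h h' hj
      fin_cases i <;> fin_cases j <;> fin_cases j' <;>
        first
        | rfl
        | exact absurd h (by decide)
        | exact absurd h' (by decide)
        | exact absurd hj hfg
        | exact absurd hj.symm hfg
        | exact absurd hj hbc
        | exact absurd hj.symm hbc
    have hsize : ∀ i : Fin 5, ![1, 2, 1, 2, 1] i ≤ 2 := by decide
    refine h ⟨fun x => m x.1 ⟨x.2, x.2.2.trans_le (hsize _)⟩, ?_, ?_⟩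
    · rintro ⟨i, j⟩ ⟨i', j'⟩ hxy
      rcases lt_trichotomy i i' with hi | rfl | hi
      · exact absurd hxy (hlt _ _ _ _ hi).ne
      · have := hne i _ _ j.2 j'.2 hxy
        rw [Fin.mk.injEq, ← Fin.ext_iff] at this
        obtain rfl : j = j' := this
        rfl
      · exact absurd hxy (hlt _ _ _ _ hi).ne'
    · rintro x y (rfl | hxy)
      · exact le_rfl
      · exact (hlt _ _ _ _ hxy).le

instance : DecidableLE H := fun x y => inferInstanceAs (Decidable (x = y ∨ y ∈ x.above))

theorem H.lt_iff (x y : H) : x < y ↔ y ∈ x.above := by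
  rw [lt_iff_le_not_ge]
  revert x y
  decide

/-- Diamonds `(a, b, c, d)` of `H` that no 2-colouring avoids. -/
def H.diamonds : List (H × H × H × H) :=
  [(.v11, .v10, .v9, .v6), (.v11, .v8, .v7, .v3), (.v10, .v8, .v2, .v1), (.v9, .v5, .v3, .v1),
    (.v11, .v5, .v4, .v2), (.v11, .v7, .v6, .v1), (.v9, .v6, .v4, .v2), (.v10, .v7, .v6, .v3),
    (.v11, .v10, .v4, .v1), (.v6, .v3, .v2, .v1), (.v11, .v8, .v6, .v3), (.v11, .v10, .v9, .v2),
    (.v9, .v4, .v3, .v1), (.v9, .v6, .v5, .v1), (.v11, .v9, .v7, .v1), (.v11, .v3, .v2, .v1),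
    (.v11, .v10, .v9, .v3), (.v11, .v9, .v6, .v2), (.v10, .v8, .v6, .v1), (.v10, .v7, .v2, .v1),
    (.v11, .v6, .v5, .v1), (.v11, .v10, .v6, .v3), (.v11, .v8, .v4, .v1), (.v10, .v8, .v7, .v3),
    (.v11, .v7, .v4, .v1), (.v10, .v3, .v2, .v1), (.v11, .v10, .v9, .v1), (.v11, .v10, .v5, .v2),
    (.v11, .v9, .v8, .v3), (.v11, .v7, .v2, .v1), (.v9, .v3, .v2, .v1), (.v11, .v8, .v6, .v1),
    (.v11, .v7, .v6, .v3), (.v11, .v6, .v3, .v1), (.v10, .v8, .v7, .v1), (.v10, .v6, .v3, .v1),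
    (.v9, .v6, .v2, .v1), (.v11, .v10, .v6, .v1), (.v11, .v4, .v3, .v1), (.v11, .v10, .v2, .v1),
    (.v11, .v9, .v3, .v1), (.v10, .v7, .v6, .v1)]

theorem H.isDiamond_of_mem {q : H × H × H × H} (hq : q ∈ H.diamonds) :
    IsDiamond q.1 q.2.1 q.2.2.1 q.2.2.2 := by
  have h : (H.diamonds.all fun q => q.2.1 ∈ q.1.above ∧ q.2.2.1 ∈ q.1.above ∧
      q.2.2.2 ∈ q.2.1.above ∧ q.2.2.2 ∈ q.2.2.1.above ∧ q.2.1 ≠ q.2.2.1) = true := by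
    decide +kernel
  simpa only [IsDiamond, H.lt_iff, decide_eq_true_eq] using List.all_eq_true.1 h q hq

/-- A colouring is spelled out as eleven Booleans so that evaluation runs through all `2 ^ 11`
cases. -/
theorem H.exists_mono_diamond : ∀ x₁ x₂ x₃ x₄ x₅ x₆ x₇ x₈ x₉ x₁₀ x₁₁ : Bool,
    let f : H → Bool := fun x => H.casesOn x x₁ x₂ x₃ x₄ x₅ x₆ x₇ x₈ x₉ x₁₀ x₁₁
    (H.diamonds.any fun q => (f q.1 == f q.2.1) && (f q.1 == f q.2.2.1) &&
      (f q.1 == f q.2.2.2)) = true := by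
  decide +kernel

/-- `H` is `(𝒫(2), 𝒫(2))`-Ramsey. -/
theorem H.isRamseyPair : IsRamseyPair (Finset (Fin 2)) (Finset (Fin 2)) H := by
  intro χ
  set g : H → Bool := fun x => χ x = 1
  have hg : ∀ x, (g x = true → χ x = 1) ∧ (g x = false → χ x = 0) := fun x => by
    simp only [g, decide_eq_true_eq, decide_eq_false_iff_not]
    exact ⟨id, fun h => by omega⟩
  have hany := H.exists_mono_diamond (g .v1) (g .v2) (g .v3) (g .v4) (g .v5) (g .v6)
    (g .v7) (g .v8) (g .v9) (g .v10) (g .v11)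
  have hf : ∀ x : H, (H.casesOn x (g .v1) (g .v2) (g .v3) (g .v4) (g .v5) (g .v6)
    (g .v7) (g .v8) (g .v9) (g .v10) (g .v11) : Bool) = g x := fun x => by cases x <;> rfl
  simp only [List.any_eq_true, Bool.and_eq_true, beq_iff_eq, hf] at hany
  obtain ⟨q, hq, ⟨h1, h2⟩, h3⟩ := hany
  rw [hasMonoCopy_diamond_iff, hasMonoCopy_diamond_iff]
  have hd := H.isDiamond_of_mem hq
  cases h0 : g q.1 with
  | false =>
    exact Or.inl ⟨_, _, _, _, hd, (hg _).2 h0, (hg _).2 (h1 ▸ h0), (hg _).2 (h2 ▸ h0),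
      (hg _).2 (h3 ▸ h0)⟩
  | true =>
    exact Or.inr ⟨_, _, _, _, hd, (hg _).1 h0, (hg _).1 (h1 ▸ h0), (hg _).1 (h2 ▸ h0),
      (hg _).1 (h3 ▸ h0)⟩

end Ramsey

/-! ### The upper bound for the critical exponent of `C(1,2,1,2,1)` -/

section LevelsBound

open Real

/-- The argument is `8 * q` for the `q` of `cStar_levels_le`; the next lemma treats `8 * p`. With `y
= (1 - x) / (1 + x)`, the series of `log ((1 + y) / (1 - y))` gives `-log x`. -/
theorem log_836616_bounds : -0.178390095128 < log 0.836616 ∧ log 0.836616 < -0.178390095127 := by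
  have h1 := sum_range_le_log_div (x := 163384 / 1836616) (by norm_num) (by norm_num) 8
  have h2 := log_div_le_sum_range_add (x := 163384 / 1836616) (by norm_num) (by norm_num) 8
  have h3 : ((1 + 163384 / 1836616) / (1 - 163384 / 1836616) : ℝ) = (0.836616)⁻¹ := by norm_num
  rw [h3, log_inv] at h1 h2
  norm_num [Finset.sum_range_succ] at h1 h2
  constructor <;> norm_num <;> linarith

theorem log_790846_bounds : -0.234652020435 < log 0.790846 ∧ log 0.790846 < -0.234652020434 := by
  have h1 := sum_range_le_log_div (x := 209154 / 1790846) (by norm_num) (by norm_num) 8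
  have h2 := log_div_le_sum_range_add (x := 209154 / 1790846) (by norm_num) (by norm_num) 8
  have h3 : ((1 + 209154 / 1790846) / (1 - 209154 / 1790846) : ℝ) = (0.790846)⁻¹ := by norm_num
  rw [h3, log_inv] at h1 h2
  norm_num [Finset.sum_range_succ] at h1 h2
  constructor <;> norm_num <;> linarith

theorem log_two_bounds : 0.693147180559 < log 2 ∧ log 2 < 0.693147180560 := by
  have h1 := sum_range_le_log_div (x := 1 / 3) (by norm_num) (by norm_num) 16
  have h2 := log_div_le_sum_range_add (x := 1 / 3) (by norm_num) (by norm_num) 16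
  have h3 : ((1 + 1 / 3) / (1 - 1 / 3) : ℝ) = 2 := by norm_num
  rw [h3] at h1 h2
  norm_num [Finset.sum_range_succ] at h1 h2
  constructor <;> norm_num <;> linarith

instance {t : ℕ} (n : Fin t → ℕ) : DecidableEq (Levels n) :=
  inferInstanceAs (DecidableEq (Σ i : Fin t, Fin (n i)))

instance {t : ℕ} (n : Fin t → ℕ) : DecidableLE (Levels n) :=
  fun x y => inferInstanceAs (Decidable (x = y ∨ x.1 < y.1))

/-- The least element of `C(1,2,1,2,1)`. -/
abbrev lbot : Levels ![1, 2, 1, 2, 1] := ⟨0, 0, by decide⟩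

/-- The greatest element of `C(1,2,1,2,1)`. -/
abbrev ltop : Levels ![1, 2, 1, 2, 1] := ⟨4, 0, by decide⟩

instance : Nonempty (Levels ![1, 2, 1, 2, 1]) := ⟨lbot⟩

theorem card_antichains_levels :
    (antichains (Finset.univ : Finset (Levels ![1, 2, 1, 2, 1]))).card = 10 := by
  have h : antichains (Finset.univ : Finset (Levels ![1, 2, 1, 2, 1])) =
      Finset.univ.filter fun S => ∀ x ∈ S, ∀ y ∈ S, x ≤ y → x = y := by
    ext S
    simp only [mem_antichains, Finset.subset_univ, true_and, Finset.mem_filter, Finset.mem_univ]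
    exact ⟨fun h x hx y hy hxy => h.eq hx hy hxy,
      fun h x hx y hy hne hxy => hne (h x hx y hy hxy)⟩
  rw [h]
  decide +kernel

theorem levels_antichain_cases : ∀ S : Finset (Levels ![1, 2, 1, 2, 1]),
    (∀ x ∈ S, ∀ y ∈ S, x ≤ y → x = y) → S = ∅ ∨ S = {lbot} ∨
      ((¬ ∃ z ∈ S, z ≤ lbot) ∧ ∃ z ∈ S, z ≤ ltop) := by
  decide +kernel

/-- A dual certificate using only two sets `Q`. The up-sets of `∅` and `{lbot}` have total weight
`s`; the other eight antichains are merged into one when only `lbot` and `ltop` are observed. Cross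
entropy bounds both constraints linearly in `s`. -/
theorem cStar_levels_le : cStar (Levels ![1, 2, 1, 2, 1]) ≤ 0.3289037391 := by
  classical
  refine Real.sSup_le ?_ (by norm_num)
  rintro c ⟨-, α, hα, hc⟩
  -- Chosen with `2 * q + 8 * p = 1`, where `8 * p = 0.790846`, so both reference laws have total
  -- mass 1.
  set q : ℝ := 0.104577
  set p : ℝ := 0.09885575
  set s := ∑ S, if S.1 = ∅ ∨ S.1 = {lbot} then α S else 0
  have hne : (∅ : Finset (Levels ![1, 2, 1, 2, 1])) ≠ {lbot} := (Finset.singleton_ne_empty _).symm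
  have hempty : (∅ : Finset (Levels ![1, 2, 1, 2, 1])) ∈ antichains Finset.univ :=
    mem_antichains.2 ⟨Finset.empty_subset _, by simp⟩
  have hsing : ∀ Q : Finset (Levels ![1, 2, 1, 2, 1]), ∀ x ∈ Q, {x} ∈ antichains Q := fun Q x hx =>
    mem_antichains.2 ⟨Finset.singleton_subset_iff.2 hx, by simp⟩
  have hsplit : ∀ u v : ℝ, ∑ S, α S * (if S.1 = ∅ ∨ S.1 = {lbot} then u else v) =
      s * u + (1 - s) * v := by
    intro u v
    rw [← hα.2, ← Finset.sum_sub_distrib, Finset.sum_mul, Finset.sum_mul, ← Finset.sum_add_distrib]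
    refine Finset.sum_congr rfl fun S _ => ?_
    split_ifs <;> ring
  have hs0 : 0 ≤ s := Finset.sum_nonneg fun S _ => by split_ifs <;> simp [hα.1]
  have h1 : 7 * c ≤ -(s * log q + (1 - s) * log p) := by
    have h := hc Finset.univ Finset.univ_nonempty
    have hcard : (Finset.univ : Finset (Levels ![1, 2, 1, 2, 1])).card = 7 := by decide
    have hself : (fun S : Antichain (Levels ![1, 2, 1, 2, 1]) => shadow Finset.univ S.1) =
        fun S => S.1 := funext fun S => shadow_self S.2
    rw [relExponent_eq_ent, hcard, hself, le_div_iff₀ (by norm_num)] at h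
    have hcross := ent_le_cross hα (fun S => S.2)
      (r := fun T => if T = ∅ ∨ T = {lbot} then q else p)
      (fun T _ => by split_ifs <;> norm_num [q, p]) (by
        have hf : (antichains (Finset.univ : Finset (Levels ![1, 2, 1, 2, 1]))).filter
            (fun T => T = ∅ ∨ T = {lbot}) = {∅, {lbot}} := by
          ext T
          simp only [Finset.mem_filter, Finset.mem_insert, Finset.mem_singleton,
            and_iff_right_iff_imp]
          rintro (rfl | rfl)
          · exact hempty
          · exact hsing _ _ (Finset.mem_univ _)
        have hcount := Finset.card_filter_add_card_filter_not
          (s := antichains (Finset.univ : Finset (Levels ![1, 2, 1, 2, 1])))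
          (fun T => T = ∅ ∨ T = {lbot})
        rw [card_antichains_levels, hf, Finset.card_pair hne] at hcount
        rw [Finset.sum_ite, Finset.sum_const, Finset.sum_const, hf, Finset.card_pair hne,
          show _ = 8 from Nat.add_left_cancel hcount]
        norm_num [q, p])
    simp only [apply_ite log] at hcross
    rw [hsplit] at hcross
    push_cast at h
    linarith
  have h2 : 2 * c ≤ -(s * log q + (1 - s) * log 0.790846) := by
    have h := hc {lbot, ltop} (by simp)
    have hcard : ({lbot, ltop} : Finset (Levels ![1, 2, 1, 2, 1])).card = 2 := by decide
    rw [relExponent_eq_ent, hcard, le_div_iff₀ (by norm_num)] at h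
    set Q : Finset (Levels ![1, 2, 1, 2, 1]) := {lbot, ltop}
    have hcases : ∀ S : Antichain (Levels ![1, 2, 1, 2, 1]),
        (shadow Q S.1 = ∅ ∧ S.1 = ∅) ∨ (shadow Q S.1 = {lbot} ∧ S.1 = {lbot}) ∨
        (shadow Q S.1 = {ltop} ∧ ¬ (S.1 = ∅ ∨ S.1 = {lbot})) := by
      rintro ⟨S, hS⟩
      have hS' : ∀ x ∈ S, ∀ y ∈ S, x ≤ y → x = y := fun x hx y hy =>
        (mem_antichains.1 hS).2.eq hx hy
      rcases levels_antichain_cases S hS' with rfl | rfl | ⟨ha, hb⟩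
      · exact Or.inl ⟨shadow_self (mem_antichains.2 ⟨Finset.empty_subset _, by simp⟩), rfl⟩
      · exact Or.inr (Or.inl ⟨shadow_self (hsing _ _ (by simp [Q])), rfl⟩)
      · refine Or.inr (Or.inr ⟨?_, ?_⟩)
        · rw [← shadow_self (hsing Q ltop (by simp [Q])), shadow_eq_shadow_iff]
          have hbt : ¬ ltop ≤ lbot := by decide
          simp only [Q, Finset.mem_insert, Finset.mem_singleton, forall_eq_or_imp, forall_eq,
            exists_eq_left, le_refl]
          simp [ha, hb, hbt]
        · rintro (rfl | rfl)
          · simp at hb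
          · simp at ha
    have hcross := ent_le_cross hα (f := fun S => shadow Q S.1) (s := {∅, {lbot}, {ltop}})
      (fun S => by rcases hcases S with h | h | h <;> simp [h.1])
      (r := fun T => if T = ∅ ∨ T = {lbot} then q else 0.790846)
      (fun T _ => by split_ifs <;> norm_num [q, p]) (by
        rw [Finset.sum_insert (by decide), Finset.sum_insert (by decide), Finset.sum_singleton]
        rw [if_pos (by simp), if_pos (by simp), if_neg (by decide)]
        norm_num [q])
    have heq : ∀ S : Antichain (Levels ![1, 2, 1, 2, 1]),
        (shadow Q S.1 = ∅ ∨ shadow Q S.1 = {lbot}) ↔ (S.1 = ∅ ∨ S.1 = {lbot}) := fun S => by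
      have hd : ({ltop} : Finset (Levels ![1, 2, 1, 2, 1])) ≠ {lbot} := by decide
      rcases hcases S with h | h | h
      · rw [h.1, h.2]
      · rw [h.1, h.2]
      · simp [h.1, h.2, hd]
    simp only [apply_ite log, heq] at hcross
    rw [hsplit] at hcross
    push_cast at h
    linarith
  have hA := log_836616_bounds
  have hE := log_790846_bounds
  have hl := log_two_bounds
  have h8 : log 8 = 3 * log 2 := by
    rw [show (8 : ℝ) = 2 ^ 3 by norm_num, log_pow]
    norm_num
  have hqlog : log q = log 0.836616 - 3 * log 2 := by
    rw [← h8, ← log_div (by norm_num) (by norm_num)]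
    norm_num [q]
  have hplog : log p = log 0.790846 - 3 * log 2 := by
    rw [← h8, ← log_div (by norm_num) (by norm_num)]
    norm_num [p]
  rw [hqlog] at h1 h2
  rw [hplog] at h1
  set A := log 0.836616
  set E := log 0.790846
  set l := log 2
  -- The multiplier of the second constraint nearly cancels the coefficient of `s`, leaving it just
  -- nonpositive.
  have h3 : (7 + 2 * 0.0278086655) * c ≤
      3 * l - E - 0.0278086655 * E + s * (E - A + 0.0278086655 * (E - A + 3 * l)) := by
    linarith
  have h4 : s * (E - A + 0.0278086655 * (E - A + 3 * l)) ≤ 0 :=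
    mul_nonpos_of_nonneg_of_nonpos hs0 (by linarith)
  linarith

end LevelsBound

/-! ### The lower bound for the critical exponent of `H` -/

section Coins

open Real

variable {ι κ κ' : Type*} [Fintype ι] {α : ι → ℝ}

theorem sum_le_marg (hα : ∀ i, 0 ≤ α i) {f : ι → κ} {t : κ} {s : Finset ι}
    (h : ∀ j ∈ s, f j = t) : ∑ j ∈ s, α j ≤ marg α f t := by
  classical
  rw [marg, ← Finset.sum_filter]
  exact Finset.sum_le_sum_of_subset_of_nonneg
    (fun j hj => Finset.mem_filter.2 ⟨Finset.mem_univ _, h j hj⟩) fun j _ _ => hα j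

theorem marg_anti (hα : ∀ i, 0 ≤ α i) {f : ι → κ} {g : ι → κ'} {i : ι}
    (h : ∀ j, f j = f i → g j = g i) : marg α f (f i) ≤ marg α g (g i) := by
  classical
  unfold marg
  refine Finset.sum_le_sum fun j _ => ?_
  by_cases h1 : f j = f i
  · simp [h1, h j h1]
  · rw [if_neg h1]
    split_ifs <;> simp [hα]

/-- If a measure-preserving involution `τ` fixes `f` and changes `h` on the set `D`, then
observing `h` in addition to `f` gains at least one bit on `D`. -/
theorem ent_add_coin (hα : α ∈ stdSimplex ℝ ι) {τ : ι → ι} (hτ : Function.Involutive τ)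
    (hατ : ∀ i, α (τ i) = α i) {f : ι → κ} (hf : ∀ i, f (τ i) = f i) {h : ι → κ'}
    {D : Finset ι} (hD : ∀ i ∈ D, h (τ i) ≠ h i) :
    ent α f + (∑ i ∈ D, α i) * log 2 ≤ ent α fun i => (f i, h i) := by
  classical
  -- `R` is the orbit under `τ`. It determines `f`, so by submodularity `h` adds at least as much
  -- entropy to `f` as to `R`.
  set R : ι → Finset ι := fun i => {i, τ i}
  have hR : ∀ i j, R i = R j → i = j ∨ i = τ j := fun i j hij => by
    have : i ∈ R j := hij ▸ Finset.mem_insert_self _ _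
    simpa [R] using this
  have hRτ : ∀ i, R (τ i) = R i := fun i => by simp [R, hτ i, Finset.pair_comm]
  have hfR : ∀ i j, R i = R j → f i = f j := fun i j hij => by
    rcases hR i j hij with rfl | rfl
    · rfl
    · exact hf j
  have hsub := ent_submodular hα f R h
  have e1 : ent α (fun i => (f i, R i, h i)) = ent α fun i => (R i, h i) :=
    ent_congr fun i j => by
      simp only [Prod.mk.injEq, and_iff_right_iff_imp]
      exact fun H => hfR i j H.1
  have e2 : ent α (fun i => (f i, R i)) = ent α R := ent_congr fun i j => by
    simp only [Prod.mk.injEq, and_iff_right_iff_imp]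
    exact hfR i j
  -- Given its orbit, a point of `D` is one of two equally likely points told apart by `h`, which is
  -- worth `log 2`.
  have hgain : ∀ i, (if i ∈ D then α i * log 2 else 0) ≤
      α i * log (marg α R (R i)) - α i * log (marg α (fun i => (R i, h i)) (R i, h i)) := by
    intro i
    rcases (hα.1 i).eq_or_lt with h0 | h0
    · simp [← h0]
    rw [← mul_sub]
    have hp : 0 < marg α (fun i => (R i, h i)) (R i, h i) := marg_pos hα.1 (fun i => (R i, h i)) h0
    split_ifs with hi
    · refine mul_le_mul_of_nonneg_left ?_ h0.le
      have hpair : 2 * α i ≤ marg α R (R i) := by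
        have hne : i ≠ τ i := fun H => hD i hi (congrArg h H.symm)
        refine le_trans (le_of_eq ?_) (sum_le_marg hα.1 (s := {i, τ i}) fun j hj => ?_)
        · rw [Finset.sum_pair hne, hατ, two_mul]
        · rcases Finset.mem_insert.1 hj with rfl | hj
          · rfl
          · rw [Finset.mem_singleton.1 hj, hRτ]
      have hsingle : marg α (fun i => (R i, h i)) (R i, h i) = α i := by
        unfold marg
        rw [Finset.sum_eq_single_of_mem i (Finset.mem_univ i)]
        · simp
        · intro j _ hj
          refine if_neg fun H => ?_
          rw [Prod.mk.injEq] at H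
          rcases hR j i H.1 with rfl | rfl
          · exact hj rfl
          · exact hD i hi H.2
      rw [hsingle, ← log_div (by linarith) h0.ne']
      refine log_le_log two_pos ?_
      rwa [le_div_iff₀ h0]
    · refine mul_nonneg h0.le (sub_nonneg.2 (log_le_log hp ?_))
      exact marg_anti hα.1 (f := fun i => (R i, h i)) (g := R) fun j H => (Prod.mk.inj H).1
  have hsum := Finset.sum_le_sum fun i (_ : i ∈ Finset.univ) => hgain i
  rw [Finset.sum_sub_distrib, ← Finset.sum_filter, Finset.filter_mem_eq_inter,
    Finset.univ_inter, ← Finset.sum_mul] at hsum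
  rw [e1, e2] at hsub
  simp only [ent] at hsub ⊢
  linarith

/-- An entropy bound for integer weights, from an inequality between natural numbers. -/
theorem le_ent_of_pow_le {w : ι → ℕ} (hw : ∀ i, 0 < w i) {N : ℕ} (hN : ∑ i, w i = N) (hN0 : 0 < N)
    {f : ι → κ} {m : ι → ℕ} (hm : ∀ k, marg (fun i => (w i : ℝ)) f (f k) = m k) {s t l : ℕ}
    (ht : 0 < t) (h : (∏ k, m k ^ (t * w k)) * 2 ^ (s * N * l) ≤ N ^ (N * t)) :
    l * (s / t * log 2) ≤ ent (fun i => (w i : ℝ) / N) f := by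
  classical
  have hNr : (0 : ℝ) < N := by exact_mod_cast hN0
  have htr : (0 : ℝ) < t := by exact_mod_cast ht
  have hm0 : ∀ k, 0 < (m k : ℝ) := fun k => by
    rw [← hm k]
    exact marg_pos (fun i => Nat.cast_nonneg _) f (by exact_mod_cast hw k)
  have hmarg : ∀ k, marg (fun i => (w i : ℝ) / N) f (f k) = m k / N := fun k => by
    rw [← hm k]
    unfold marg
    rw [Finset.sum_div]
    exact Finset.sum_congr rfl fun i _ => by split_ifs <;> simp
  have hNs : ∑ k, (w k : ℝ) = N := by exact_mod_cast hN
  have hent : ent (fun i => (w i : ℝ) / N) f = log N - (∑ k, w k * log (m k)) / N := by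
    rw [ent]
    have : ∀ k ∈ Finset.univ, (w k : ℝ) / N * log (marg (fun i => (w i : ℝ) / N) f (f k)) =
        w k * log (m k) / N - w k * (log N / N) := fun k _ => by
      rw [hmarg, log_div (hm0 k).ne' hNr.ne']
      ring
    rw [Finset.sum_congr rfl this, Finset.sum_sub_distrib, ← Finset.sum_div, ← Finset.sum_mul, hNs]
    field_simp
    ring
  -- The logarithm of the integer inequality; division by `N * t` turns it into the entropy bound.
  have hlog : t * ∑ k, w k * log (m k) + s * N * l * log 2 ≤ N * t * log N := by
    have h1 : (∏ k, (m k : ℝ) ^ (t * w k)) * 2 ^ (s * N * l) ≤ (N : ℝ) ^ (N * t) := by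
      exact_mod_cast h
    have hprod : 0 < ∏ k, (m k : ℝ) ^ (t * w k) := Finset.prod_pos fun k _ => pow_pos (hm0 k) _
    have h2 := log_le_log (by positivity) h1
    rw [log_mul hprod.ne' (by positivity), log_prod fun k _ => (pow_pos (hm0 k) _).ne', log_pow,
      log_pow] at h2
    simp only [log_pow] at h2
    push_cast at h2
    rw [Finset.mul_sum]
    simpa only [mul_assoc] using h2
  rw [hent, le_sub_iff_add_le, ← mul_le_mul_iff_right₀ (mul_pos hNr htr)]
  refine le_trans (le_of_eq ?_) hlog
  field_simp
  ring

end Coins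

/-! ### An explicit weighting for `H` -/

section LowerH

open Real

/-- Membership of the elements of the chain-like part `{v₁, v₂, v₃, v₆, v₉, v₁₀, v₁₁}` of `H` in
its ten up-sets. -/
def H.base (k : Fin 10) : H → Bool
  | .v1 => 1 ≤ k
  | .v2 => k = 2 ∨ 4 ≤ k
  | .v3 => 3 ≤ k
  | .v6 => 5 ≤ k
  | .v9 => k = 6 ∨ 8 ≤ k
  | .v10 => 7 ≤ k
  | .v11 => k = 9
  | _ => false

/-- The weights of the ten up-sets. -/
def H.weight : Fin 10 → ℕ := ![40, 26, 37, 37, 54, 54, 37, 37, 26, 40]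

/-- The sample space: an up-set of the chain-like part and four fair coins. -/
abbrev H.Sample := Fin 10 × Bool × Bool × Bool × Bool

/-- The random up-set of `H`. -/
def H.up (ω : H.Sample) : H → Bool
  -- `v4` is forced in by `v9` and forced out when `v2` is absent; otherwise its coin decides. The
  -- other three coins follow the same pattern.
  | .v4 => H.base ω.1 .v2 && (H.base ω.1 .v9 || ω.2.1)
  | .v5 => H.base ω.1 .v2 && (H.base ω.1 .v9 || ω.2.2.1)
  | .v7 => H.base ω.1 .v3 && (H.base ω.1 .v10 || ω.2.2.2.1)
  | .v8 => H.base ω.1 .v3 && (H.base ω.1 .v10 || ω.2.2.2.2)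
  | x => H.base ω.1 x

/-- The law of the sample. -/
noncomputable def H.prob (ω : H.Sample) : ℝ := H.weight ω.1 / 388 / 16

theorem H.up_mono : ∀ (ω : H.Sample) (x y : H), x ≤ y → H.up ω x → H.up ω y := by
  decide +kernel

/-- The elements of the chain-like part of `H`. -/
def H.chain : List H := [.v1, .v2, .v3, .v6, .v9, .v10, .v11]

/-- The weight of the up-sets agreeing with the `k`-th one on the set with indicator `b`. -/
def H.fibre (b : H → Bool) (k : Fin 10) : ℕ :=
  ∑ j, if H.chain.all fun x => !b x || H.base j x == H.base k x then H.weight j else 0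

/-- The entropy inequality for the set with indicator `b`, in integer form. -/
def H.powCheck (b : H → Bool) : Bool :=
  (∏ k, H.fibre b k ^ (113 * H.weight k)) * 2 ^ (53 * 388 * H.chain.countP b) ≤
    388 ^ (388 * 113)

/-- Exact integer arithmetic replaces logarithms for the `2 ^ 7` subsets of the chain-like part. -/
theorem H.powCheck_casesOn : ∀ x₁ x₂ x₃ x₆ x₉ x₁₀ x₁₁ : Bool,
    H.powCheck (fun x => H.casesOn x x₁ x₂ x₃ false false x₆ false false x₉ x₁₀ x₁₁) = true := by
  decide +kernel

theorem H.powCheck_eq_true {b : H → Bool} (hb : ∀ x, x ∉ H.chain → b x = false) :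
    H.powCheck b = true := by
  have hcases : (fun x => H.casesOn x (b .v1) (b .v2) (b .v3) false false (b .v6) false false
      (b .v9) (b .v10) (b .v11) : H → Bool) = b := by
    funext x
    cases x <;> first | rfl | exact (hb _ (by decide)).symm
  rw [← hcases]
  exact H.powCheck_casesOn _ _ _ _ _ _ _

/-- The joint entropy of the indicators of the elements of `Q`. -/
noncomputable def H.entropy (Q : Finset H) : ℝ :=
  ent H.prob fun ω => Q.filter fun x => H.up ω x = true

theorem H.filter_eq_iff {Q : Finset H} {f g : H → Bool} :
    (Q.filter fun x => f x = true) = (Q.filter fun x => g x = true) ↔ ∀ x ∈ Q, f x = g x := by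
  rw [Finset.filter_inj']
  exact forall₂_congr fun x _ => Bool.eq_iff_iff.symm

theorem H.prob_mem_stdSimplex : H.prob ∈ stdSimplex ℝ H.Sample := by
  refine ⟨fun ω => by unfold H.prob; positivity, ?_⟩
  have h : ∑ ω : H.Sample, H.weight ω.1 = 388 * 16 := by decide +kernel
  have h' : ∑ ω : H.Sample, (H.weight ω.1 : ℝ) = 388 * 16 := by exact_mod_cast h
  unfold H.prob
  rw [← Finset.sum_div, ← Finset.sum_div, h']
  norm_num

/-- Here `τ` is the flip of the coin of `v`. The coin matters with probability `182 / 388`, which is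
just above `53 / 113`, so `v` pays for itself in every `Q`. -/
theorem H.entropy_insert {v : H} {τ : H.Sample → H.Sample} (hτ : Function.Involutive τ)
    (hτ1 : ∀ ω, (τ ω).1 = ω.1) (hx : ∀ ω x, x ≠ v → H.up (τ ω) x = H.up ω x)
    (hD : ∑ ω with H.up (τ ω) v ≠ H.up ω v, H.weight ω.1 = 182 * 16) {Q : Finset H} (hv : v ∉ Q) :
    H.entropy Q + 53 / 113 * log 2 ≤ H.entropy (insert v Q) := by
  have hprob : ∑ ω with H.up (τ ω) v ≠ H.up ω v, H.prob ω = 182 / 388 := by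
    have h' : ∑ ω with H.up (τ ω) v ≠ H.up ω v, (H.weight ω.1 : ℝ) = 182 * 16 := by
      exact_mod_cast hD
    unfold H.prob
    rw [← Finset.sum_div, ← Finset.sum_div, h']
    norm_num
  have h := ent_add_coin H.prob_mem_stdSimplex hτ (fun ω => by simp only [H.prob, hτ1])
    (f := fun ω => Q.filter fun x => H.up ω x = true) (h := fun ω => H.up ω v)
    (fun ω => H.filter_eq_iff.2 fun x hxQ => hx ω x fun H => hv (H ▸ hxQ))
    (D := Finset.univ.filter fun ω => H.up (τ ω) v ≠ H.up ω v)
    (fun ω hω => (Finset.mem_filter.1 hω).2)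
  rw [hprob] at h
  have e : H.entropy (insert v Q) =
      ent H.prob fun ω => (Q.filter fun x => H.up ω x = true, H.up ω v) :=
    ent_congr fun ω ω' => by
      rw [H.filter_eq_iff, Prod.mk.injEq, H.filter_eq_iff, Finset.forall_mem_insert, and_comm]
  rw [e]
  have : 0 < log 2 := log_pos one_lt_two
  refine le_trans ?_ h
  unfold H.entropy
  linarith

theorem H.le_entropy_of_erase {v : H} {τ : H.Sample → H.Sample} (hτ : Function.Involutive τ)
    (hτ1 : ∀ ω, (τ ω).1 = ω.1) (hx : ∀ ω x, x ≠ v → H.up (τ ω) x = H.up ω x)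
    (hD : ∑ ω with H.up (τ ω) v ≠ H.up ω v, H.weight ω.1 = 182 * 16) {Q : Finset H}
    (hQ : (Q.erase v).card * (53 / 113 * log 2) ≤ H.entropy (Q.erase v)) :
    Q.card * (53 / 113 * log 2) ≤ H.entropy Q := by
  by_cases hv : v ∈ Q
  · have h := H.entropy_insert hτ hτ1 hx hD (Finset.notMem_erase v Q)
    rw [Finset.insert_erase hv] at h
    rw [← Finset.card_erase_add_one hv]
    push_cast
    linarith
  · rwa [Finset.erase_eq_of_notMem hv] at hQ

theorem H.marg_prob : marg H.prob Prod.fst = fun k => (H.weight k : ℝ) / (388 : ℕ) := by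
  classical
  ext k
  unfold marg
  rw [Fintype.sum_prod_type, Finset.sum_eq_single k (fun j _ hj => by simp [hj]) (by simp)]
  simp only [if_true, H.prob, Finset.sum_const, Finset.card_univ, Fintype.card_prod,
    Fintype.card_bool]
  norm_num
  ring

/-- The coins are invisible on the chain-like part, so only the ten-point law matters, and
`H.powCheck` settles it. -/
theorem H.le_entropy_of_subset_chain {Q : Finset H} (hQ : ∀ x ∈ Q, x ∈ H.chain) :
    Q.card * (53 / 113 * log 2) ≤ H.entropy Q := by
  have e : H.entropy Q =
      ent (marg H.prob Prod.fst) fun k => Q.filter fun x => H.base k x = true := by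
    have hup : ∀ ω x, x ∈ H.chain → H.up ω x = H.base ω.1 x := fun ω x => by
      cases x <;> first | exact fun _ => rfl | exact fun h => absurd h (by decide)
    have hfun : (fun ω : H.Sample => Q.filter fun x => H.up ω x = true) =
        fun ω => Q.filter fun x => H.base ω.1 x = true :=
      funext fun ω => H.filter_eq_iff.2 fun x hx => hup ω x (hQ x hx)
    rw [H.entropy, hfun, ent_marg]
  set b : H → Bool := fun x => x ∈ Q
  have hnot : ∀ x, x ∉ H.chain → b x = false := fun x hx => by
    simpa [b] using fun h => hx (hQ x h)
  have hcard : Q.card = H.chain.countP b := by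
    have : Q = (H.chain.filter b).toFinset := by
      ext x
      simp only [List.mem_toFinset, List.mem_filter, b, decide_eq_true_eq]
      exact ⟨fun h => ⟨hQ x h, h⟩, fun h => h.2⟩
    rw [this, List.toFinset_card_of_nodup ((by decide : H.chain.Nodup).filter _),
      List.countP_eq_length_filter]
  have hpow := H.powCheck_eq_true hnot
  rw [H.powCheck, decide_eq_true_eq, ← hcard] at hpow
  rw [e, H.marg_prob]
  have := le_ent_of_pow_le (w := H.weight) (by decide) (N := 388) (by decide) (by norm_num)
    (f := fun k => Q.filter fun x => H.base k x = true) (m := H.fibre b) (fun k => ?_)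
    (s := 53) (t := 113) (l := Q.card) (by norm_num) hpow
  · exact_mod_cast this
  · unfold marg H.fibre
    push_cast
    refine Finset.sum_congr rfl fun j _ => ?_
    refine if_congr ?_ rfl rfl
    rw [H.filter_eq_iff, List.all_eq_true]
    constructor
    · intro h x _
      by_cases hx : x ∈ Q <;> simp [b, hx, h]
    · intro h x hx
      have := h x (hQ x hx)
      simpa [b, hx] using this

theorem H.le_entropy (Q : Finset H) : Q.card * (53 / 113 * log 2) ≤ H.entropy Q := by
  -- The four elements with coins are peeled off, each by the flip of its own coin.
  refine H.le_entropy_of_erase (v := .v4) (τ := fun ω => (ω.1, !ω.2.1, ω.2.2))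
    (fun ω => by simp) (fun ω => rfl)
    (fun ω x hx => by cases x <;> first | rfl | exact absurd rfl hx)
    (by decide +kernel) ?_
  refine H.le_entropy_of_erase (v := .v5) (τ := fun ω => (ω.1, ω.2.1, !ω.2.2.1, ω.2.2.2))
    (fun ω => by simp) (fun ω => rfl)
    (fun ω x hx => by cases x <;> first | rfl | exact absurd rfl hx)
    (by decide +kernel) ?_
  refine H.le_entropy_of_erase (v := .v7)
    (τ := fun ω => (ω.1, ω.2.1, ω.2.2.1, !ω.2.2.2.1, ω.2.2.2.2))
    (fun ω => by simp) (fun ω => rfl)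
    (fun ω x hx => by cases x <;> first | rfl | exact absurd rfl hx)
    (by decide +kernel) ?_
  refine H.le_entropy_of_erase (v := .v8)
    (τ := fun ω => (ω.1, ω.2.1, ω.2.2.1, ω.2.2.2.1, !ω.2.2.2.2))
    (fun ω => by simp) (fun ω => rfl)
    (fun ω x hx => by cases x <;> first | rfl | exact absurd rfl hx)
    (by decide +kernel) ?_
  refine H.le_entropy_of_subset_chain fun x hx => ?_
  simp only [Finset.mem_erase] at hx
  cases x <;> first | decide | exact absurd hx (by simp)

instance : Nonempty H := ⟨.v1⟩

/-- The minimal elements of the random up-set define the weighting; their shadow in `Q` records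
exactly which elements of `Q` lie in the up-set. -/
theorem le_cStar_H : 53 / 113 * log 2 ≤ cStar H := by
  have hlog : 0 < log 2 := log_pos one_lt_two
  set U : H.Sample → Finset H := fun ω => Finset.univ.filter fun x => H.up ω x = true
  set S : H.Sample → Antichain H := fun ω =>
    ⟨shadow Finset.univ (U ω), shadow_mem_antichains _ _⟩
  have hU : ∀ ω x, (∃ z ∈ (S ω).1, z ≤ x) ↔ H.up ω x = true := fun ω x => by
    rw [exists_mem_shadow_le_iff (Finset.mem_univ x)]
    simp only [U, Finset.mem_filter, Finset.mem_univ, true_and]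
    exact ⟨fun ⟨z, hz, hzx⟩ => H.up_mono ω z x hzx hz, fun h => ⟨x, h, le_rfl⟩⟩
  refine le_cStar (by positivity) (marg_mem_stdSimplex H.prob_mem_stdSimplex S) fun Q hQ => ?_
  have e : (ent H.prob fun ω => shadow Q (S ω).1) = H.entropy Q := ent_congr fun ω ω' => by
    rw [shadow_eq_shadow_iff, H.filter_eq_iff]
    exact forall₂_congr fun x _ => by
      rw [hU, hU]
      exact Bool.eq_iff_iff.symm
  rw [relExponent_eq_ent, ent_marg, e, le_div_iff₀ (by exact_mod_cast hQ.card_pos), mul_comm]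
  exact H.le_entropy Q

end LowerH

/-! ### Ramsey exponents -/

section Exponents

theorem whp_isRamseyPair {P Q F : Type*} [PartialOrder P] [PartialOrder Q] [PartialOrder F]
    [Fintype F] (hF : IsRamseyPair P Q F) {c : ℝ} (hc0 : 0 ≤ c) (hc : c < cStar F) :
    WHP c fun _ S => IsRamseyPair P Q S :=
  (whp_hasCopy hc0 hc).mono fun _ _ h => h.ramseyPair hF

theorem whp_not_isRamseyPair_diamond {c : ℝ} (hc : cStar (Levels ![1, 2, 1, 2, 1]) < c) :
    WHP c fun _ S => ¬ IsRamseyPair (Finset (Fin 2)) (Finset (Fin 2)) S :=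
  (whp_not_hasCopy hc).mono fun _ _ => not_ramsey_of_not_hasCopy

theorem retention_anti {c d : ℝ} (h : c ≤ d) (n : ℕ) : retention d n ≤ retention c n :=
  Set.monotone_projIcc _ (Real.exp_le_exp.2 (by gcongr))

/-- If `d < c`, the Ramsey property, being monotone, would pass from `c` to the denser poset at `d`,
and one probability would tend to both 0 and 1. -/
theorem le_of_whp_of_whp_not {P Q : Type*} [PartialOrder P] [PartialOrder Q] {c d : ℝ}
    (hc : WHP c fun _ S => IsRamseyPair P Q S) (hd : WHP d fun _ S => ¬ IsRamseyPair P Q S) :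
    c ≤ d := by
  by_contra! h
  have hd' : WHP d fun _ S => IsRamseyPair P Q S :=
    tendsto_of_tendsto_of_tendsto_of_le_of_le hc tendsto_const_nhds
      (fun n => law_mono (retention_anti h.le n) fun _ hS _ hSS' => IsRamseyPair.mono hSS' hS)
      fun _ => prob_le_one
  rw [whp_iff_real] at hd'
  rw [whp_not_iff_real] at hd
  exact zero_ne_one (tendsto_nhds_unique hd hd')

end Exponents

end RandomPoset

theorem theorem2 :
    (∀ c : ℝ, 0 ≤ c → c < 0.3250121326 →
      WHP c fun _ S => IsRamsey (Finset (Fin 2)) 2 S) ∧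
    (∀ c : ℝ, 0.3289037391 < c →
      WHP c fun _ S => ¬ IsRamsey (Finset (Fin 2)) 2 S) ∧
    IsRamseyPair (Finset (Fin 2)) (Finset (Fin 2)) RandomPoset.H ∧
    cStar RandomPoset.H ≤ cRamLower (Finset (Fin 2)) (Finset (Fin 2)) ∧
    cRamLower (Finset (Fin 2)) (Finset (Fin 2)) ≤
      cRamUpper (Finset (Fin 2)) (Finset (Fin 2)) ∧
    cRamUpper (Finset (Fin 2)) (Finset (Fin 2)) ≤ cStar (Levels ![1, 2, 1, 2, 1]) := by
  have hlow : (0.3250121326 : ℝ) < cStar RandomPoset.H := by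
    refine lt_of_lt_of_le ?_ le_cStar_H
    have := log_two_bounds.1
    linarith
  have hup : cStar (Levels ![1, 2, 1, 2, 1]) ≤ 0.3289037391 := cStar_levels_le
  have hmemL : ∀ c, 0 < c → c < cStar RandomPoset.H →
      c ∈ {c : ℝ | 0 < c ∧ WHP c fun _ S => IsRamseyPair (Finset (Fin 2)) (Finset (Fin 2)) S} :=
    fun c h0 hc => ⟨h0, whp_isRamseyPair H.isRamseyPair h0.le hc⟩
  have hmemU : ∀ c, cStar (Levels ![1, 2, 1, 2, 1]) < c →
      c ∈ {c : ℝ | 0 < c ∧ WHP c fun _ S => ¬ IsRamseyPair (Finset (Fin 2)) (Finset (Fin 2)) S} :=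
    fun c hc => ⟨cStar_nonneg.trans_lt hc, whp_not_isRamseyPair_diamond hc⟩
  refine ⟨fun c h0 hc => ?_, fun c hc => ?_, H.isRamseyPair, ?_, ?_, ?_⟩
  · simp only [isRamsey_two_iff]
    exact whp_isRamseyPair H.isRamseyPair h0 (hc.trans hlow)
  · simp only [isRamsey_two_iff]
    exact whp_not_isRamseyPair_diamond (hup.trans_lt hc)
  · have hbdd : BddAbove {c : ℝ | 0 < c ∧
        WHP c fun _ S => IsRamseyPair (Finset (Fin 2)) (Finset (Fin 2)) S} :=
      ⟨1, fun c hc => le_of_whp_of_whp_not hc.2 (hmemU 1 (by linarith)).2⟩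
    refine le_of_forall_lt fun c hc => ?_
    -- The maximum with 0 is taken because only positive exponents enter the supremum.
    obtain ⟨d, hd, hd'⟩ := exists_between (max_lt hc (show (0 : ℝ) < _ by linarith))
    exact ((le_max_left _ _).trans_lt hd).trans_le
      (le_csSup hbdd (hmemL d ((le_max_right _ _).trans_lt hd) hd'))
  · refine csSup_le ⟨0.3, hmemL 0.3 (by norm_num) (by linarith)⟩ fun c hc => ?_
    exact le_csInf ⟨1, hmemU 1 (by linarith)⟩ fun d hd => le_of_whp_of_whp_not hc.2 hd.2
  · refine le_of_forall_gt_imp_ge_of_dense fun c hc => ?_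
    exact csInf_le ⟨0, fun d hd => hd.1.le⟩ (hmemU c hc)
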